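/- Let $(M,g)$ and $(N,h)$ be smooth Riemannian manifolds of dimensions $d$ and $n$, and let $\widetilde M=\mathbb R\times M$ carry the Lorentzian metric $\eta=\mathrm{diag}(-1,g_{ij})$. Let $u:(\widetilde M,\eta)\to(N,h)$ be a smooth wave map, i.e. in local coordinates $$\frac{1}{\sqrt{|\eta|}}\,D_\alpha\big(\sqrt{|\eta|}\,\eta^{\alpha\beta}\partial_\beta u\big)=0,$$ where $D$ is the pull-back covariant derivative on $u^*TN$. Let $e=(e_1,\dots,e_n)$ be the Coulomb frame of $u^*TN$ or, more generally, any smooth orthonormal frame of $u^*TN$ over $\widetilde M$ (a Coulomb frame is a smooth orthonormal frame that is rotated so that the connection form $A$ below is co-closed on each slice $\{t\}\times M$). Write $du=q^ae_a$ with the $1$-forms $q^a=q^a_\alpha dx^\alpha$, $q^a_\alpha=u^*h(\partial_\alpha u,e_a)$. Let $A^c_{a,\alpha}$ be the connection form, $D_\alpha e_a=A^c_{a,\alpha}e_c$, and let $F$ be the curvature tensor of $u^*TN$, $(D_\alpha D_\beta-D_\beta D_\alpha)e_a=F^c_{a,\alpha\beta}e_c$. Let $\nabla$ be the Levi-Civita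 connection of $(\widetilde M,\eta)$, raise indices with $\eta$, and let $\Box=d\delta+\delta d$, where $d$ is the exterior derivative on $\widetilde M$ and $\delta$ the codifferential: $\delta\omega=-\frac{1}{\sqrt{|\eta|}}\partial_\alpha(\sqrt{|\eta|}\,\eta^{\alpha\beta}\omega_\beta)$ on $1$-forms and $(\delta\omega)_\beta=-(\nabla^\alpha\omega)_{\alpha\beta}$ on $2$-forms. Then, in local coordinates $(t,x)$ on $\widetilde M=\mathbb R\times M$, with $x$ any local coordinates on $M$ and with $A,F$ acting as matrices on $q=(q^1,\dots,q^n)$, $$\delta q^c=A^c_{a,\alpha}\,\eta^{\alpha\beta}\,q^a_\beta,\qquad dq^c=-A^c_b\wedge q^b,$$ and $q$ satisfies the wave equation of $1$-forms $$(\Box q)_\gamma=F_{\gamma\alpha}\,q^\alpha+A_\alpha A^\alpha\,q_\gamma+(\nabla^\alpha A)_\alpha\,q_\gamma+2A^\alpha(\nabla_\alpha q)_\gamma .$$ -/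

import Mathlib

open scoped Manifold ContDiff
open Bundle

noncomputable section

namespace WaveMap

/-- `ℝᵐ`, the model space of an `m`-dimensional manifold. -/
abbrev Coord (m : ℕ) : Type := EuclideanSpace ℝ (Fin m)

/-- A smooth Riemannian metric on an `m`-dimensional manifold `X`. -/
abbrev Metric (m : ℕ) (X : Type*) [TopologicalSpace X] [ChartedSpace (Coord m) X]
    [IsManifold (𝓡 m) ∞ X] : Type _ :=
  ContMDiffRiemannianMetric (𝓡 m) ∞ (Coord m) (fun x : X => TangentSpace (𝓡 m) x)

/-- The partial derivative `∂_i f` at the point `y` of `ℝᵐ`. -/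
def pd {m : ℕ} (i : Fin m) (f : Coord m → ℝ) (y : Coord m) : ℝ :=
  fderiv ℝ f y (EuclideanSpace.single i 1)

/-! ### Tensor calculus in coordinates

Here `G y` is the matrix `(G_{ij}(y))` of a (pseudo-)Riemannian metric in coordinates and
`(G y)⁻¹ i j` is `G^{ij}(y)`. A `1`-form is given by its components `θ i`, a `2`-form by its
components `θ i j`. -/

section Coordinates

variable {m : ℕ}

/-- Christoffel symbols
`Γ^k_{ij} = 1/2 ∑_l G^{kl} (∂_i G_{lj} + ∂_j G_{il} - ∂_l G_{ij})`. -/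
def christoffel (G : Coord m → Matrix (Fin m) (Fin m) ℝ) (k i j : Fin m) (y : Coord m) : ℝ :=
  (1 / 2) * ∑ l, (G y)⁻¹ k l *
    (pd i (fun y' => G y' l j) y + pd j (fun y' => G y' i l) y - pd l (fun y' => G y' i j) y)

/-- `√|G|`, where `|G|` is the absolute value of the determinant. -/
def sqrtDet (G : Coord m → Matrix (Fin m) (Fin m) ℝ) (y : Coord m) : ℝ :=
  Real.sqrt |(G y).det|

/-- Covariant derivative of a `1`-form: `nabla₁ G θ i j` is
`(∇_i θ)_j = ∂_i θ_j - Γ^k_{ij} θ_k`. -/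
def nabla₁ (G : Coord m → Matrix (Fin m) (Fin m) ℝ) (θ : Fin m → Coord m → ℝ)
    (i j : Fin m) (y : Coord m) : ℝ :=
  pd i (θ j) y - ∑ k, christoffel G k i j y * θ k y

/-- Covariant derivative of a `2`-form: `nabla₂ G θ l i j` is
`(∇_l θ)_{ij} = ∂_l θ_{ij} - Γ^k_{li} θ_{kj} - Γ^k_{lj} θ_{ik}`. -/
def nabla₂ (G : Coord m → Matrix (Fin m) (Fin m) ℝ) (θ : Fin m → Fin m → Coord m → ℝ)
    (l i j : Fin m) (y : Coord m) : ℝ :=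
  pd l (θ i j) y - ∑ k, christoffel G k l i y * θ k j y - ∑ k, christoffel G k l j y * θ i k y

/-- Exterior derivative of a `1`-form: `(dθ)_{ij} = ∂_i θ_j - ∂_j θ_i`. -/
def extD (θ : Fin m → Coord m → ℝ) (i j : Fin m) (y : Coord m) : ℝ :=
  pd i (θ j) y - pd j (θ i) y

/-- Codifferential of a `1`-form: `δθ = -(1/√|G|) ∂_i (√|G| G^{ij} θ_j)`. -/
def codiff₁ (G : Coord m → Matrix (Fin m) (Fin m) ℝ) (θ : Fin m → Coord m → ℝ)
    (y : Coord m) : ℝ :=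
  -((1 / sqrtDet G y) *
    ∑ i, pd i (fun y' => sqrtDet G y' * ∑ j, (G y')⁻¹ i j * θ j y') y)

/-- Codifferential of a `2`-form: `(δθ)_j = -∇^i θ_{ij} = -G^{il} (∇_l θ)_{ij}`. -/
def codiff₂ (G : Coord m → Matrix (Fin m) (Fin m) ℝ) (θ : Fin m → Fin m → Coord m → ℝ)
    (j : Fin m) (y : Coord m) : ℝ :=
  -∑ i, ∑ l, (G y)⁻¹ i l * nabla₂ G θ l i j y

/-- The Hodge Laplacian `d δ + δ d` on `1`-forms. -/
def hodgeLaplacian (G : Coord m → Matrix (Fin m) (Fin m) ℝ) (θ : Fin m → Coord m → ℝ)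
    (j : Fin m) (y : Coord m) : ℝ :=
  pd j (codiff₁ G θ) y + codiff₂ G (extD θ) j y

end Coordinates

/-! ### Charts -/

section Charts

variable {m : ℕ} {X : Type*} [TopologicalSpace X] [ChartedSpace (Coord m) X]
  [IsManifold (𝓡 m) ∞ X]

/-- The coordinate vector field `∂_i` of the chart `φ`, at the point with coordinates `y`. -/
def coordVec (φ : OpenPartialHomeomorph X (Coord m)) (i : Fin m) (y : Coord m) :
    TangentSpace (𝓡 m) (φ.symm y) :=
  mfderiv (𝓡 m) (𝓡 m) φ.symm y (EuclideanSpace.single i (1 : ℝ) : Coord m)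

/-- The coefficients `g_{ij}` of a Riemannian metric in the chart `φ`. -/
def metricCoeff (g : Metric m X) (φ : OpenPartialHomeomorph X (Coord m)) (y : Coord m) :
    Matrix (Fin m) (Fin m) ℝ :=
  Matrix.of fun i j => g.inner (φ.symm y) (coordVec φ i y) (coordVec φ j y)

/-- The space part `(p¹, …, pᵈ)` of a point `p = (p⁰, p¹, …, pᵈ)` of `ℝ^{1+d}`. -/
def spacePart {d : ℕ} (p : Coord (d + 1)) : Coord d :=
  WithLp.toLp 2 fun i : Fin d => p i.succ

/-- The coordinates `(t, φ)` on `ℝ × X`: the point with coordinates `p = (t, y)` is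
`(t, φ⁻¹ y)`. The index `0` is the time index. -/
def spacetimePoint (φ : OpenPartialHomeomorph X (Coord m)) (p : Coord (m + 1)) : ℝ × X :=
  (p 0, φ.symm (spacePart p))

/-- The coordinate vector field `∂_α` of the coordinates `(t, φ)` on `ℝ × X`. -/
def spacetimeVec (φ : OpenPartialHomeomorph X (Coord m)) (α : Fin (m + 1)) (p : Coord (m + 1)) :
    TangentSpace (𝓘(ℝ, ℝ).prod (𝓡 m)) (spacetimePoint φ p) :=
  mfderiv (𝓡 (m + 1)) (𝓘(ℝ, ℝ).prod (𝓡 m)) (spacetimePoint φ) p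
    (EuclideanSpace.single α (1 : ℝ) : Coord (m + 1))

/-- The Lorentzian metric `η = diag(-1, g_{ij})` on `ℝ × X` in the coordinates `(t, φ)`. -/
def eta (g : Metric m X) (φ : OpenPartialHomeomorph X (Coord m)) (p : Coord (m + 1)) :
    Matrix (Fin (m + 1)) (Fin (m + 1)) ℝ :=
  Matrix.of fun α β =>
    Fin.cases (motive := fun _ => ℝ)
      (Fin.cases (motive := fun _ => ℝ) (-1) (fun _ => 0) β)
      (fun i => Fin.cases (motive := fun _ => ℝ) 0
        (fun j => metricCoeff g φ (spacePart p) i j) β) α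

end Charts

/-! ### Maps `u : ℝ × M → N` and frames of `u^*TN` -/

section Maps

variable {d n : ℕ}
  {M : Type*} [TopologicalSpace M] [ChartedSpace (Coord d) M] [IsManifold (𝓡 d) ∞ M]
  {N : Type*} [TopologicalSpace N] [ChartedSpace (Coord n) N] [IsManifold (𝓡 n) ∞ N]

/-- The coordinates `p` at which `u` can be read in the coordinates `(t, φ)` on `ℝ × M` and the
chart `κ` of `N`. -/
def chartDomain (φ : OpenPartialHomeomorph M (Coord d)) (κ : OpenPartialHomeomorph N (Coord n))
    (u : ℝ × M → N) : Set (Coord (d + 1)) :=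
  {p | spacePart p ∈ φ.target ∧ u (spacetimePoint φ p) ∈ κ.source}

/-- The coordinate representation `κ ∘ u ∘ (t, φ)⁻¹` of `u`. -/
def localRep (φ : OpenPartialHomeomorph M (Coord d)) (κ : OpenPartialHomeomorph N (Coord n))
    (u : ℝ × M → N) (p : Coord (d + 1)) : Coord n :=
  κ (u (spacetimePoint φ p))

/-- The pull-back covariant derivative `D_α` on `u^*TN`, in coordinates: a section of `u^*TN` is
given by its components `V p k` in the chart `κ`, and
`(D_α V)^k = ∂_α V^k + Γ^k_{ij}(u) ∂_α u^i V^j` with the Christoffel symbols of `(N, h)`. -/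
def pullbackD (h : Metric n N) (φ : OpenPartialHomeomorph M (Coord d))
    (κ : OpenPartialHomeomorph N (Coord n)) (u : ℝ × M → N) (α : Fin (d + 1))
    (V : Coord (d + 1) → Fin n → ℝ) (p : Coord (d + 1)) (k : Fin n) : ℝ :=
  pd α (fun p' => V p' k) p +
    ∑ i, ∑ j, christoffel (metricCoeff h κ) k i j (localRep φ κ u p) *
      pd α (fun p' => localRep φ κ u p' i) p * V p j

/-- `u : (ℝ × M, η) → (N, h)` is a wave map: in all local coordinates
`(1/√|η|) D_α (√|η| η^{αβ} ∂_β u) = 0`. -/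
def IsWaveMap (g : Metric d M) (h : Metric n N) (u : ℝ × M → N) : Prop :=
  ∀ φ ∈ IsManifold.maximalAtlas (𝓡 d) ∞ M, ∀ κ ∈ IsManifold.maximalAtlas (𝓡 n) ∞ N,
    ∀ p ∈ chartDomain φ κ u, ∀ k : Fin n,
      (1 / sqrtDet (eta g φ) p) *
        ∑ α, pullbackD h φ κ u α
          (fun p' k' => sqrtDet (eta g φ) p' *
            ∑ β, (eta g φ p')⁻¹ α β * pd β (fun p'' => localRep φ κ u p'' k') p') p k = 0

/-- A smooth global orthonormal frame `e₁, …, eₙ` of the bundle `u^*TN` over `ℝ × M`. A Coulomb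
frame is such a frame, rotated so that its connection form is co-closed on every slice `{t} × M`. -/
structure IsOrthonormalFrame (h : Metric n N) (u : ℝ × M → N)
    (e : Fin n → ∀ z : ℝ × M, TangentSpace (𝓡 n) (u z)) : Prop where
  smooth : ∀ a, ContMDiff (𝓘(ℝ, ℝ).prod (𝓡 d)) (𝓡 n).tangent ∞
    (fun z => (⟨u z, e a z⟩ : TangentBundle (𝓡 n) N))
  orthonormal : ∀ z a b, h.inner (u z) (e a z) (e b z) = if a = b then 1 else 0

variable (h : Metric n N) (φ : OpenPartialHomeomorph M (Coord d))
  (κ : OpenPartialHomeomorph N (Coord n)) (u : ℝ × M → N)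
  (e : Fin n → ∀ z : ℝ × M, TangentSpace (𝓡 n) (u z))

/-- `q^a_α = u^*h(∂_α u, e_a)`, the components in the coordinates `(t, φ)` of the `1`-forms `q^a`
with `du = q^a e_a`. -/
def frameForm (a : Fin n) (α : Fin (d + 1)) (p : Coord (d + 1)) : ℝ :=
  h.inner (u (spacetimePoint φ p))
    (mfderiv (𝓘(ℝ, ℝ).prod (𝓡 d)) (𝓡 n) u (spacetimePoint φ p) (spacetimeVec φ α p))
    (e a (spacetimePoint φ p))

/-- The components `e_a^k` of the frame vector `e_a` in the chart `κ`. -/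
def frameComp (a : Fin n) (p : Coord (d + 1)) (k : Fin n) : ℝ :=
  let v : Coord n := mfderiv (𝓡 n) (𝓡 n) κ (u (spacetimePoint φ p)) (e a (spacetimePoint φ p))
  v k

/-- `u^*h(V, e_c)` for a section `V` of `u^*TN` given by its components in the chart `κ`. -/
def pairFrame (V : Coord (d + 1) → Fin n → ℝ) (c : Fin n) (p : Coord (d + 1)) : ℝ :=
  ∑ i, ∑ j, metricCoeff h κ (localRep φ κ u p) i j * V p i * frameComp φ κ u e c p j

/-- The connection form: `connForm h φ κ u e c a α` is `A^c_{a,α} = u^*h(D_α e_a, e_c)`, so that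
`D_α e_a = A^c_{a,α} e_c`. -/
def connForm (c a : Fin n) (α : Fin (d + 1)) (p : Coord (d + 1)) : ℝ :=
  pairFrame h φ κ u e (pullbackD h φ κ u α (frameComp φ κ u e a)) c p

/-- The curvature tensor of `u^*TN` in the frame `e`: `curvForm h φ κ u e c a α β` is
`F^c_{a,αβ} = u^*h(D_α D_β e_a - D_β D_α e_a, e_c)`. -/
def curvForm (c a : Fin n) (α β : Fin (d + 1)) (p : Coord (d + 1)) : ℝ :=
  pairFrame h φ κ u e
    (fun p' k => pullbackD h φ κ u α (pullbackD h φ κ u β (frameComp φ κ u e a)) p' k -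
      pullbackD h φ κ u β (pullbackD h φ κ u α (frameComp φ κ u e a)) p' k) c p

end Maps

end WaveMap

end

/-! Everything comes from one differentiation rule. The pull-back connection is metric, so `∂_α⟨V,
e_c⟩ = ⟨D_α V, e_c⟩ + ⟨V, D_α e_c⟩`. Expanding the last pairing by Parseval in the orthonormal frame
and using that `A` is skew gives `∂_α⟨V, e_c⟩ = ⟨D_α V, e_c⟩ - A^c_{a,α}⟨V, e_a⟩`, which is
`pd_pairing_frame`. It is used for three sections `V`: `∂_β u`, where the symmetry `D_α ∂_β u = D_β
∂_α u` gives `dq = -A ∧ q`; `√|η| η^{αβ} ∂_β u`, where the wave map equation gives `δq = A^α q_α`;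
`D_β e_a`, where antisymmetrization gives `F = dA + A ∧ A`.

The wave equation is then algebra (`hodgeLaplacian_eq`). The first-order equations hold on an open
set, so they may be differentiated. On one side `dδq = ∇_γ(A^α q_α)`, where `dq = -A ∧ q` trades
`∇_γ q_α` for `∇_α q_γ` plus terms quadratic in `A`. On the other side `δdq = ∇^α(A_α q_γ - A_γ
q_α)`, where `∇^α q_α = -δq` is known. The derivatives of `A` and the commutator of `A` combine to
`F_{γα} q^α`, and `A^α ∇_α q_γ` occurs twice. Second covariant derivatives of `q` are never
commuted, so no Ricci term appears.

The tensor calculus uses only that the metric coefficients are smooth, symmetric and nondegenerate;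
the signature plays no role. The remaining work identifies the invariant objects on `ℝ × M` and `N`
with their coordinate expressions. -/

open scoped Topology

noncomputable section

namespace WaveMap

/-! ### Partial derivatives on `ℝᵐ`. -/

section PartialDerivatives

variable {m : ℕ} {f f' : Coord m → ℝ} {y : Coord m} {i : Fin m}

theorem _root_.ContDiffAt.pd (hf : ContDiffAt ℝ ∞ f y) (i : Fin m) :
    ContDiffAt ℝ ∞ (pd i f) y :=
  (hf.fderiv_right (m := ∞) le_rfl).clm_apply contDiffAt_const

theorem smooth_differentiableAt {E : Type*} [NormedAddCommGroup E] [NormedSpace ℝ E]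
    {F : Type*} [NormedAddCommGroup F] [NormedSpace ℝ F] {f : E → F} {y : E}
    (hf : ContDiffAt ℝ ∞ f y) : DifferentiableAt ℝ f y :=
  hf.differentiableAt (by simp)

theorem pd_congr (hff' : f =ᶠ[𝓝 y] f') (i : Fin m) : pd i f y = pd i f' y := by
  simp only [pd, hff'.fderiv_eq]

theorem pd_const (c : ℝ) : pd i (fun _ => c) y = 0 := by simp [pd]

theorem pd_sub (hf : ContDiffAt ℝ ∞ f y) (hf' : ContDiffAt ℝ ∞ f' y) :
    pd i (fun z => f z - f' z) y = pd i f y - pd i f' y := by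
  simp only [pd]
  rw [fderiv_fun_sub (smooth_differentiableAt hf) (smooth_differentiableAt hf')]; rfl

theorem pd_mul (hf : ContDiffAt ℝ ∞ f y) (hf' : ContDiffAt ℝ ∞ f' y) :
    pd i (fun z => f z * f' z) y = pd i f y * f' y + f y * pd i f' y := by
  simp only [pd]
  rw [fderiv_fun_mul (smooth_differentiableAt hf) (smooth_differentiableAt hf')]
  simp
  ring

theorem pd_sum {ι : Type*} (s : Finset ι) {f : ι → Coord m → ℝ}
    (hf : ∀ k ∈ s, ContDiffAt ℝ ∞ (f k) y) :
    pd i (fun z => ∑ k ∈ s, f k z) y = ∑ k ∈ s, pd i (f k) y := by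
  simp only [pd]
  rw [fderiv_fun_sum (fun k hk => smooth_differentiableAt (hf k hk))]
  simp

theorem pd_comm (hf : ContDiffAt ℝ ∞ f y) (i j : Fin m) :
    pd i (pd j f) y = pd j (pd i f) y := by
  have hd : DifferentiableAt ℝ (fderiv ℝ f) y :=
    smooth_differentiableAt (hf.fderiv_right (m := ∞) le_rfl)
  have hs : IsSymmSndFDerivAt ℝ f y := hf.isSymmSndFDerivAt
    (by simpa using WithTop.coe_le_coe.2 (le_top : (2 : ℕ∞) ≤ ⊤))
  have key : ∀ i j : Fin m, pd i (pd j f) y =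
      fderiv ℝ (fderiv ℝ f) y (EuclideanSpace.single i 1) (EuclideanSpace.single j 1) := by
    intro i j
    have : pd j f = fun z => fderiv ℝ f z (EuclideanSpace.single j 1) := rfl
    rw [this, pd, fderiv_clm_apply hd (differentiableAt_const _)]
    simp
  rw [key, key]
  exact hs _ _

theorem eq_sum_single {n : ℕ} (v : Coord n) :
    v = ∑ i, v i • (EuclideanSpace.single i 1 : Coord n) := by
  ext j
  simp [Pi.single_apply]

/-- The chain rule. -/
theorem pd_comp {n : ℕ} {f : Coord n → ℝ} {w : Coord m → Coord n}
    (hf : ContDiffAt ℝ ∞ f (w y)) (hw : ContDiffAt ℝ ∞ w y) :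
    pd i (fun z => f (w z)) y = ∑ k, pd k f (w y) * pd i (fun z => w z k) y := by
  have hc : ∀ k, pd i (fun z => w z k) y = (fderiv ℝ w y (EuclideanSpace.single i 1)) k := by
    intro k
    have := ((EuclideanSpace.proj k : Coord n →L[ℝ] ℝ).hasFDerivAt.comp y
      (smooth_differentiableAt hw).hasFDerivAt).fderiv
    simp only [pd]
    change fderiv ℝ (⇑(EuclideanSpace.proj k : Coord n →L[ℝ] ℝ) ∘ w) y _ = _
    rw [this]; rfl
  have := ((smooth_differentiableAt hf).hasFDerivAt.comp y
      (smooth_differentiableAt hw).hasFDerivAt).fderiv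
  simp only [hc]
  simp only [pd]
  change fderiv ℝ (f ∘ w) y _ = _
  rw [this, ContinuousLinearMap.comp_apply]
  conv_lhs => rw [eq_sum_single (fderiv ℝ w y (EuclideanSpace.single i 1))]
  simp [mul_comm]

theorem smooth_coord {n : ℕ} {w : Coord m → Coord n} (hw : ContDiffAt ℝ ∞ w y) (k : Fin n) :
    ContDiffAt ℝ ∞ (fun z => w z k) y :=
  (EuclideanSpace.proj k : Coord n →L[ℝ] ℝ).contDiff.contDiffAt.comp y hw

end PartialDerivatives

/-! ### Levi-Civita calculus in coordinates, for a metric of any signature. -/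

section Tensors

variable {m : ℕ} {G : Coord m → Matrix (Fin m) (Fin m) ℝ} {y : Coord m}

theorem smooth_det {k : ℕ} {B : Coord m → Matrix (Fin k) (Fin k) ℝ}
    (hB : ∀ i j, ContDiffAt ℝ ∞ (fun z => B z i j) y) :
    ContDiffAt ℝ ∞ (fun z => (B z).det) y := by
  simp only [Matrix.det_apply]
  refine ContDiffAt.sum fun σ _ => ?_
  refine ContDiffAt.const_smul _ ?_
  exact contDiffAt_prod fun i _ => hB _ _

theorem smooth_inv (hG : ∀ i j, ContDiffAt ℝ ∞ (fun z => G z i j) y) (hdet : (G y).det ≠ 0)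
    (i j : Fin m) : ContDiffAt ℝ ∞ (fun z => (G z)⁻¹ i j) y := by
  simp only [Matrix.inv_def, Matrix.smul_apply, Matrix.adjugate_apply, Ring.inverse_eq_inv',
    smul_eq_mul]
  refine ((smooth_det hG).inv hdet).mul (smooth_det fun a b => ?_)
  simp only [Matrix.updateRow_apply]
  split_ifs
  · exact contDiffAt_const
  · exact hG _ _

theorem smooth_christoffel (hG : ∀ i j, ContDiffAt ℝ ∞ (fun z => G z i j) y)
    (hdet : (G y).det ≠ 0) (k i j : Fin m) : ContDiffAt ℝ ∞ (christoffel G k i j) y := by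
  refine contDiffAt_const.mul (ContDiffAt.sum fun l _ => (smooth_inv hG hdet _ _).mul ?_)
  exact (((hG _ _).pd _).add ((hG _ _).pd _)).sub ((hG _ _).pd _)

theorem christoffel_symm (hsymm : ∀ z i j, G z i j = G z j i) (k i j : Fin m) (y : Coord m) :
    christoffel G k i j y = christoffel G k j i y := by
  simp only [christoffel]
  congr 1
  refine Finset.sum_congr rfl fun l _ => ?_
  rw [show (fun z => G z i j) = fun z => G z j i from funext fun z => hsymm z i j,
    show (fun z => G z l j) = fun z => G z j l from funext fun z => hsymm z l j,
    show (fun z => G z i l) = fun z => G z l i from funext fun z => hsymm z i l]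
  ring

theorem mul_inv_apply (hdet : (G y).det ≠ 0) (i j : Fin m) :
    ∑ k, G y i k * (G y)⁻¹ k j = if i = j then 1 else 0 := by
  rw [← Matrix.mul_apply, Matrix.mul_nonsing_inv _ (isUnit_iff_ne_zero.2 hdet), Matrix.one_apply]

theorem inv_mul_apply (hdet : (G y).det ≠ 0) (i j : Fin m) :
    ∑ k, (G y)⁻¹ i k * G y k j = if i = j then 1 else 0 := by
  rw [← Matrix.mul_apply, Matrix.nonsing_inv_mul _ (isUnit_iff_ne_zero.2 hdet), Matrix.one_apply]

theorem inv_symm (hsymm : ∀ z i j, G z i j = G z j i) (i j : Fin m) :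
    (G y)⁻¹ i j = (G y)⁻¹ j i := by
  have : (G y).transpose = G y := by ext a b; exact hsymm _ _ _
  conv_lhs => rw [← this, ← Matrix.transpose_nonsing_inv]
  rfl

/-- Lowering the upper index cancels the inverse metric in `Γ`; what is left is linear in `∂G`, so
`pd_metric` follows by adding two instances. -/
theorem christoffel_lower (hdet : (G y).det ≠ 0) (a i j : Fin m) :
    ∑ k, G y a k * christoffel G k i j y = (1 / 2) * (pd i (fun z => G z a j) y +
      pd j (fun z => G z i a) y - pd a (fun z => G z i j) y) := by
  simp only [christoffel]
  calc _ = (1 / 2) * ∑ l, (∑ k, G y a k * (G y)⁻¹ k l) * (pd i (fun z => G z l j) y +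
      pd j (fun z => G z i l) y - pd l (fun z => G z i j) y) := by
        simp only [Finset.sum_mul, Finset.mul_sum]
        rw [Finset.sum_comm]
        refine Finset.sum_congr rfl fun l _ => Finset.sum_congr rfl fun k _ => ?_
        ring
    _ = _ := by simp [mul_inv_apply hdet]

/-- The metric is parallel: `∂_k G_{ij} = G_{il} Γ^l_{kj} + G_{jl} Γ^l_{ki}`. -/
theorem pd_metric (hsymm : ∀ z i j, G z i j = G z j i) (hdet : (G y).det ≠ 0) (k i j : Fin m) :
    pd k (fun z => G z i j) y = ∑ l, G y i l * christoffel G l k j y +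
      ∑ l, G y j l * christoffel G l k i y := by
  rw [christoffel_lower hdet, christoffel_lower hdet]
  rw [show (fun z => G z j i) = fun z => G z i j from funext fun z => hsymm z j i,
    show (fun z => G z k j) = fun z => G z j k from funext fun z => hsymm z k j,
    show (fun z => G z k i) = fun z => G z i k from funext fun z => hsymm z k i]
  ring

/-- The inverse metric is parallel. -/
theorem pd_inv (hG : ∀ i j, ContDiffAt ℝ ∞ (fun z => G z i j) y)
    (hsymm : ∀ z i j, G z i j = G z j i) (hdet : (G y).det ≠ 0) (k i j : Fin m) :
    pd k (fun z => (G z)⁻¹ i j) y = -∑ l, (G y)⁻¹ l j * christoffel G i k l y -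
      ∑ l, (G y)⁻¹ i l * christoffel G j k l y := by
  have hI := smooth_inv hG hdet
  have hev : ∀ᶠ z in 𝓝 y, (G z).det ≠ 0 :=
    (smooth_det hG).continuousAt.eventually_ne hdet
  -- Differentiate `G⁻¹ G = 1`, valid near `y` because `det G ≠ 0` is an open condition; then solve
  -- for `∂G⁻¹` by multiplying with `G⁻¹` on the right.
  have h1 : ∀ a, ∑ b, (pd k (fun z => (G z)⁻¹ i b) y * G y b a +
      (G y)⁻¹ i b * pd k (fun z => G z b a) y) = 0 := by
    intro a
    have : pd k (fun z => ∑ b, (G z)⁻¹ i b * G z b a) y = 0 := by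
      rw [pd_congr (f' := fun _ => if i = a then 1 else 0), pd_const]
      filter_upwards [hev] with z hz using inv_mul_apply hz i a
    rw [pd_sum _ (fun b _ => (hI i b).mul (hG b a))] at this
    rw [← this]
    exact Finset.sum_congr rfl fun b _ => (pd_mul (hI i b) (hG b a)).symm
  have h2 : pd k (fun z => (G z)⁻¹ i j) y =
      ∑ a, (∑ b, pd k (fun z => (G z)⁻¹ i b) y * G y b a) * (G y)⁻¹ a j := by
    simp only [Finset.sum_mul]
    rw [Finset.sum_comm]
    simp only [mul_assoc, ← Finset.mul_sum, mul_inv_apply hdet]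
    simp
  have h3 : ∀ a, ∑ b, pd k (fun z => (G z)⁻¹ i b) y * G y b a =
      -(christoffel G i k a y + ∑ l, G y a l * ∑ b, (G y)⁻¹ i b * christoffel G l k b y) := by
    intro a
    have := h1 a
    rw [Finset.sum_add_distrib] at this
    rw [eq_neg_of_add_eq_zero_left this]
    congr 1
    simp only [pd_metric hsymm hdet, mul_add, Finset.sum_add_distrib]
    congr 1
    · simp only [Finset.mul_sum]
      rw [Finset.sum_comm]
      simp only [← mul_assoc, ← Finset.sum_mul, inv_mul_apply hdet]
      simp
    · simp only [Finset.mul_sum]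
      rw [Finset.sum_comm]
      refine Finset.sum_congr rfl fun b _ => Finset.sum_congr rfl fun c _ => ?_
      ring
  rw [h2]
  simp only [h3, neg_mul, add_mul, Finset.sum_neg_distrib, Finset.sum_add_distrib, neg_add]
  rw [sub_eq_add_neg]
  congr 2
  · exact Finset.sum_congr rfl fun a _ => mul_comm _ _
  · simp only [Finset.sum_mul]
    rw [Finset.sum_comm]
    have : ∀ l a, G y a l * (∑ b, (G y)⁻¹ i b * christoffel G l k b y) * (G y)⁻¹ a j =
        (G y l a * (G y)⁻¹ a j) * (∑ b, (G y)⁻¹ i b * christoffel G l k b y) := by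
      intro l a; rw [hsymm y a l]; ring
    simp only [this, ← Finset.sum_mul, mul_inv_apply hdet]
    simp

/-- Jacobi's formula. -/
theorem pd_det (hG : ∀ i j, ContDiffAt ℝ ∞ (fun z => G z i j) y) (hdet : (G y).det ≠ 0)
    (k : Fin m) : pd k (fun z => (G z).det) y =
      (G y).det * ∑ i, ∑ j, (G y)⁻¹ j i * pd k (fun z => G z i j) y := by
  -- The determinant is multilinear in the rows, so its derivative is the sum of the determinants
  -- with one row differentiated.
  have key : pd k (fun z => (G z).det) y =
      ∑ i, ((G y).updateRow i (fun j => pd k (fun z => G z i j) y)).det := by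
    let D : ContinuousMultilinearMap ℝ (fun _ : Fin m => Fin m → ℝ) ℝ :=
      { (Matrix.detRowAlternating (n := Fin m) (R := ℝ)).toMultilinearMap with
        cont := by
          change Continuous fun B : Fin m → Fin m → ℝ => Matrix.det (Matrix.of B)
          exact Continuous.matrix_det continuous_id }
    have hrow : ∀ i, HasFDerivAt (fun z => G z i)
        (ContinuousLinearMap.pi fun j => fderiv ℝ (fun z => G z i j) y) y := fun i =>
      hasFDerivAt_pi.2 fun j => (smooth_differentiableAt (hG i j)).hasFDerivAt
    have := (HasFDerivAt.multilinear_comp D hrow).fderiv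
    change fderiv ℝ (fun z => D fun i => G z i) y _ = _
    rw [this]
    simp only [sum_apply, ContinuousLinearMap.comp_apply]
    rfl
  rw [key, Finset.mul_sum]
  refine Finset.sum_congr rfl fun i _ => ?_
  -- Cramer's rule turns a determinant with a replaced row into a pairing of that row with the
  -- adjugate, that is, with `det G • G⁻¹`.
  rw [← Matrix.cramer_transpose_apply, Matrix.cramer_eq_adjugate_mulVec, ← Matrix.adjugate_transpose,
    Matrix.mulVec, dotProduct, Finset.mul_sum]
  refine Finset.sum_congr rfl fun j _ => ?_
  rw [Matrix.inv_def, Matrix.smul_apply, Ring.inverse_eq_inv', smul_eq_mul, Matrix.transpose_apply]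
  field_simp

theorem sqrtDet_pos (hdet : (G y).det ≠ 0) : 0 < sqrtDet G y :=
  Real.sqrt_pos.2 (abs_pos.2 hdet)

theorem smooth_sqrtDet (hG : ∀ i j, ContDiffAt ℝ ∞ (fun z => G z i j) y)
    (hdet : (G y).det ≠ 0) : ContDiffAt ℝ ∞ (sqrtDet G) y :=
  ((smooth_det hG).abs hdet).sqrt (abs_ne_zero.2 hdet)

/-- `∂_k √|G| = √|G| Γ^l_{kl}`. -/
theorem pd_sqrtDet (hG : ∀ i j, ContDiffAt ℝ ∞ (fun z => G z i j) y)
    (hsymm : ∀ z i j, G z i j = G z j i) (hdet : (G y).det ≠ 0) (k : Fin m) :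
    pd k (sqrtDet G) y = sqrtDet G y * ∑ l, christoffel G l k l y := by
  have hs := smooth_sqrtDet hG hdet
  have hd := smooth_det hG
  -- Differentiating `√|G|⁴ = (det G)²` avoids both the absolute value and the sign of the
  -- determinant.
  have hsq : ∀ z, sqrtDet G z * sqrtDet G z * (sqrtDet G z * sqrtDet G z) =
      (G z).det * (G z).det := by
    intro z
    simp only [sqrtDet, Real.mul_self_sqrt (abs_nonneg _), abs_mul_abs_self]
  have h1 : pd k (fun z => sqrtDet G z * sqrtDet G z * (sqrtDet G z * sqrtDet G z)) y =
      pd k (fun z => (G z).det * (G z).det) y := by simp only [hsq]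
  rw [pd_mul (hs.mul hs) (hs.mul hs), pd_mul hs hs, pd_mul hd hd, pd_det hG hdet] at h1
  have h2 : ∑ i, ∑ j, (G y)⁻¹ j i * pd k (fun z => G z i j) y =
      2 * ∑ l, christoffel G l k l y := by
    simp only [pd_metric hsymm hdet, mul_add, Finset.sum_add_distrib, two_mul, Finset.mul_sum]
    congr 1
    · rw [Finset.sum_comm]
      refine Finset.sum_congr rfl fun j _ => ?_
      rw [Finset.sum_comm]
      simp only [← mul_assoc, ← Finset.sum_mul, inv_mul_apply hdet]
      simp
    · refine Finset.sum_congr rfl fun j _ => ?_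
      rw [Finset.sum_comm]
      simp only [inv_symm hsymm _ j, ← mul_assoc, ← Finset.sum_mul, inv_mul_apply hdet]
      simp
  have hp := sqrtDet_pos hdet
  rw [h2] at h1
  have h3 := hsq y
  have h4 : 4 * sqrtDet G y ^ 3 * pd k (sqrtDet G) y =
      4 * sqrtDet G y ^ 3 * (sqrtDet G y * ∑ l, christoffel G l k l y) := by
    linear_combination h1 - 4 * (∑ l, christoffel G l k l y) * h3
  exact mul_left_cancel₀ (by positivity) h4

/-- The codifferential of a `1`-form is minus its divergence. -/
theorem codiff₁_eq (hG : ∀ i j, ContDiffAt ℝ ∞ (fun z => G z i j) y)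
    (hsymm : ∀ z i j, G z i j = G z j i) (hdet : (G y).det ≠ 0) {θ : Fin m → Coord m → ℝ}
    (hθ : ∀ i, ContDiffAt ℝ ∞ (θ i) y) :
    codiff₁ G θ y = -∑ i, ∑ j, (G y)⁻¹ i j * nabla₁ G θ i j y := by
  have hI := smooth_inv hG hdet
  have hs := smooth_sqrtDet hG hdet
  have hp := sqrtDet_pos hdet
  have h1 : ∀ i, pd i (fun z => sqrtDet G z * ∑ j, (G z)⁻¹ i j * θ j z) y =
      sqrtDet G y * ((∑ l, christoffel G l i l y) * (∑ j, (G y)⁻¹ i j * θ j y) +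
        ∑ j, ((-∑ l, (G y)⁻¹ l j * christoffel G i i l y -
          ∑ l, (G y)⁻¹ i l * christoffel G j i l y) * θ j y + (G y)⁻¹ i j * pd i (θ j) y)) := by
    intro i
    rw [pd_mul hs (ContDiffAt.sum fun j _ => (hI i j).mul (hθ j)), pd_sqrtDet hG hsymm hdet,
      pd_sum _ fun j _ => (hI i j).mul (hθ j)]
    simp only [pd_mul (hI i _) (hθ _), pd_inv hG hsymm hdet]
    ring
  simp only [codiff₁, h1, ← Finset.mul_sum]
  rw [← mul_assoc, one_div_mul_cancel hp.ne', one_mul]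
  congr 1
  simp only [nabla₁, mul_sub, Finset.sum_sub_distrib, Finset.sum_add_distrib, sub_mul, neg_mul,
    Finset.sum_neg_distrib]
  -- The trace of `Γ` produced by `∂√|G|` cancels the trace produced by `∂G^{ij}`; the other half of
  -- `∂G^{ij}` (`h3`) is the correction inside `∇θ`.
  have h2 : ∑ i, (∑ l, christoffel G l i l y) * ∑ j, (G y)⁻¹ i j * θ j y =
      ∑ i, ∑ j, (∑ l, (G y)⁻¹ l j * christoffel G i i l y) * θ j y := by
    simp only [Finset.mul_sum, Finset.sum_mul]
    rw [Finset.sum_comm]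
    conv_rhs => rw [Finset.sum_comm]
    refine Finset.sum_congr rfl fun j _ => ?_
    rw [Finset.sum_comm]
    refine Finset.sum_congr rfl fun i _ => Finset.sum_congr rfl fun l _ => ?_
    rw [christoffel_symm hsymm]
    ring
  have h3 : ∑ i, ∑ j, (∑ l, (G y)⁻¹ i l * christoffel G j i l y) * θ j y =
      ∑ i, ∑ j, (G y)⁻¹ i j * ∑ k, christoffel G k i j y * θ k y := by
    simp only [Finset.mul_sum, Finset.sum_mul]
    refine Finset.sum_congr rfl fun i _ => ?_
    rw [Finset.sum_comm]
    simp only [mul_assoc]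
  rw [h2, h3]
  ring

/-- `Γ` is symmetric in its lower indices, so it drops out on antisymmetrizing. -/
theorem extD_eq (hsymm : ∀ z i j, G z i j = G z j i) (θ : Fin m → Coord m → ℝ) (i j : Fin m)
    (y : Coord m) : extD θ i j y = nabla₁ G θ i j y - nabla₁ G θ j i y := by
  simp only [extD, nabla₁, christoffel_symm hsymm _ i j]
  ring

/-- The Leibniz rule for `G^{ij} ξ_i θ_j`. -/
theorem pd_inv_pairing (hG : ∀ i j, ContDiffAt ℝ ∞ (fun z => G z i j) y)
    (hsymm : ∀ z i j, G z i j = G z j i) (hdet : (G y).det ≠ 0) {ξ θ : Fin m → Coord m → ℝ}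
    (hξ : ∀ i, ContDiffAt ℝ ∞ (ξ i) y) (hθ : ∀ i, ContDiffAt ℝ ∞ (θ i) y) (k : Fin m) :
    pd k (fun z => ∑ i, ∑ j, ξ i z * (G z)⁻¹ i j * θ j z) y =
      ∑ i, ∑ j, (G y)⁻¹ i j * (nabla₁ G ξ k i y * θ j y + ξ i y * nabla₁ G θ k j y) := by
  have hI := smooth_inv hG hdet
  rw [pd_sum _ fun i _ => ContDiffAt.sum fun j _ => ((hξ i).mul (hI i j)).mul (hθ j)]
  simp only [pd_sum _ fun j _ => ((hξ _).mul (hI _ j)).mul (hθ j),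
    pd_mul ((hξ _).mul (hI _ _)) (hθ _), pd_mul (hξ _) (hI _ _), pd_inv hG hsymm hdet]
  simp only [nabla₁, mul_sub, sub_mul, mul_add, add_mul, Finset.sum_add_distrib,
    Finset.sum_sub_distrib, neg_mul, mul_neg, Finset.sum_neg_distrib]
  -- The two halves of `∂G^{ij}` supply the `Γ`-terms of `∇ξ` and of `∇θ`.
  have h1 : ∑ i, ∑ j, ξ i y * (∑ l, (G y)⁻¹ l j * christoffel G i k l y) * θ j y =
      ∑ i, ∑ j, (G y)⁻¹ i j * ((∑ l, christoffel G l k i y * ξ l y) * θ j y) := by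
    simp only [Finset.mul_sum, Finset.sum_mul]
    rw [Finset.sum_comm]
    conv_rhs => rw [Finset.sum_comm]
    refine Finset.sum_congr rfl fun j _ => ?_
    rw [Finset.sum_comm]
    refine Finset.sum_congr rfl fun i _ => Finset.sum_congr rfl fun l _ => ?_
    ring
  have h2 : ∑ i, ∑ j, ξ i y * (∑ l, (G y)⁻¹ i l * christoffel G j k l y) * θ j y =
      ∑ i, ∑ j, (G y)⁻¹ i j * (ξ i y * ∑ l, christoffel G l k j y * θ l y) := by
    simp only [Finset.mul_sum, Finset.sum_mul]
    refine Finset.sum_congr rfl fun i _ => ?_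
    rw [Finset.sum_comm]
    refine Finset.sum_congr rfl fun j _ => Finset.sum_congr rfl fun l _ => ?_
    ring
  have h3 : ∀ i j, pd k (ξ i) y * (G y)⁻¹ i j * θ j y = (G y)⁻¹ i j * (pd k (ξ i) y * θ j y) :=
    fun i j => by ring
  have h4 : ∀ i j, ξ i y * (G y)⁻¹ i j * pd k (θ j) y = (G y)⁻¹ i j * (ξ i y * pd k (θ j) y) :=
    fun i j => by ring
  simp only [h1, h2, h3, h4]
  ring

theorem nabla₂_sum {ι : Type*} (s : Finset ι) {B : ι → Fin m → Fin m → Coord m → ℝ}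
    (hB : ∀ b ∈ s, ∀ i j, ContDiffAt ℝ ∞ (B b i j) y) (l i j : Fin m) :
    nabla₂ G (fun i j z => ∑ b ∈ s, B b i j z) l i j y = ∑ b ∈ s, nabla₂ G (B b) l i j y := by
  simp only [nabla₂, pd_sum s fun b hb => hB b hb _ _, Finset.sum_sub_distrib, Finset.mul_sum]
  congr 1
  · congr 1
    exact Finset.sum_comm
  · exact Finset.sum_comm

/-- Leibniz rule for `-ξ ∧ θ`, the sign with which `dq = -A ∧ q` enters `δdq`. -/
theorem nabla₂_wedge {ξ θ : Fin m → Coord m → ℝ}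
    (hξ : ∀ i, ContDiffAt ℝ ∞ (ξ i) y) (hθ : ∀ i, ContDiffAt ℝ ∞ (θ i) y) (l i j : Fin m) :
    nabla₂ G (fun i j z => ξ j z * θ i z - ξ i z * θ j z) l i j y =
      nabla₁ G ξ l j y * θ i y + ξ j y * nabla₁ G θ l i y -
        (nabla₁ G ξ l i y * θ j y + ξ i y * nabla₁ G θ l j y) := by
  simp only [nabla₂, nabla₁, pd_sub ((hξ _).mul (hθ _)) ((hξ _).mul (hθ _)),
    pd_mul (hξ _) (hθ _), mul_sub, sub_mul, Finset.mul_sum, Finset.sum_mul,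
    Finset.sum_sub_distrib]
  have e1 : ∀ k, christoffel G k l i y * (ξ j y * θ k y) = ξ j y * (christoffel G k l i y * θ k y) :=
    fun k => by ring
  have e2 : ∀ k, christoffel G k l j y * (ξ i y * θ k y) = ξ i y * (christoffel G k l j y * θ k y) :=
    fun k => by ring
  simp only [e1, e2, ← mul_assoc]
  ring

theorem nabla₂_congr {B B' : Fin m → Fin m → Coord m → ℝ}
    (hB : ∀ i j, B i j =ᶠ[𝓝 y] B' i j) (l i j : Fin m) :
    nabla₂ G B l i j y = nabla₂ G B' l i j y := by
  simp only [nabla₂, pd_congr (hB _ _), (hB _ _).eq_of_nhds]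

end Tensors

/-! ### The pull-back connection and orthonormal frames along a map. -/

section PullbackConnection

variable {m n : ℕ}

/-- The pull-back covariant derivative along `w` for the metric `H`, in coordinates. -/
def covD (H : Coord n → Matrix (Fin n) (Fin n) ℝ) (w : Coord m → Coord n) (α : Fin m)
    (V : Coord m → Fin n → ℝ) (p : Coord m) (k : Fin n) : ℝ :=
  pd α (fun p' => V p' k) p +
    ∑ i, ∑ j, christoffel H k i j (w p) * pd α (fun p' => w p' i) p * V p j

/-- The pairing `H_{ij}(w) V^i W^j` of two sections along `w`. -/
def pairing (H : Coord n → Matrix (Fin n) (Fin n) ℝ) (w : Coord m → Coord n)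
    (V W : Coord m → Fin n → ℝ) (p : Coord m) : ℝ :=
  ∑ i, ∑ j, H (w p) i j * V p i * W p j

/-- `E` is a smooth orthonormal frame along the smooth map `w`, over the open set `U`. -/
structure IsFrameAlong (U : Set (Coord m)) (H : Coord n → Matrix (Fin n) (Fin n) ℝ)
    (w : Coord m → Coord n) (E : Fin n → Coord m → Fin n → ℝ) : Prop where
  isOpen : IsOpen U
  symm : ∀ z i j, H z i j = H z j i
  det_ne_zero : ∀ p ∈ U, (H (w p)).det ≠ 0
  smooth_metric : ∀ p ∈ U, ∀ i j, ContDiffAt ℝ ∞ (fun z => H z i j) (w p)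
  smooth_map : ∀ p ∈ U, ContDiffAt ℝ ∞ w p
  smooth_frame : ∀ p ∈ U, ∀ a k, ContDiffAt ℝ ∞ (fun z => E a z k) p
  orthonormal : ∀ p ∈ U, ∀ a b, pairing H w (E a) (E b) p = if a = b then 1 else 0

variable {U : Set (Coord m)} {H : Coord n → Matrix (Fin n) (Fin n) ℝ}
  {w : Coord m → Coord n} {E : Fin n → Coord m → Fin n → ℝ} {p : Coord m}

theorem pairing_symm (hsymm : ∀ z i j, H z i j = H z j i) (V W : Coord m → Fin n → ℝ)
    (p : Coord m) : pairing H w V W p = pairing H w W V p := by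
  simp only [pairing]
  rw [Finset.sum_comm]
  refine Finset.sum_congr rfl fun i _ => Finset.sum_congr rfl fun j _ => ?_
  rw [hsymm]; ring

theorem pairing_sub_left (V V' W : Coord m → Fin n → ℝ) (p : Coord m) :
    pairing H w (fun z k => V z k - V' z k) W p = pairing H w V W p - pairing H w V' W p := by
  simp only [pairing, mul_sub, sub_mul, Finset.sum_sub_distrib]

theorem pairing_sum_left {ι : Type*} (s : Finset ι) (V : ι → Coord m → Fin n → ℝ)
    (W : Coord m → Fin n → ℝ) (p : Coord m) :
    pairing H w (fun z k => ∑ b ∈ s, V b z k) W p = ∑ b ∈ s, pairing H w (V b) W p := by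
  simp only [pairing, Finset.mul_sum, Finset.sum_mul]
  rw [Finset.sum_comm]
  conv_lhs => enter [2, j]; rw [Finset.sum_comm]
  rw [Finset.sum_comm]
  refine Finset.sum_congr rfl fun b _ => Finset.sum_comm

theorem pairing_mul_left (c : Coord m → ℝ) (V W : Coord m → Fin n → ℝ) (p : Coord m) :
    pairing H w (fun z k => c z * V z k) W p = c p * pairing H w V W p := by
  simp only [pairing, Finset.mul_sum]
  refine Finset.sum_congr rfl fun i _ => Finset.sum_congr rfl fun j _ => ?_
  ring

namespace IsFrameAlong

variable (hE : IsFrameAlong U H w E) (hp : p ∈ U)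
include hE hp

theorem eventually_mem : ∀ᶠ z in 𝓝 p, z ∈ U := hE.isOpen.mem_nhds hp

theorem smooth_metric_comp (i j : Fin n) : ContDiffAt ℝ ∞ (fun z => H (w z) i j) p :=
  (hE.smooth_metric p hp i j).comp p (hE.smooth_map p hp)

theorem smooth_pairing {V W : Coord m → Fin n → ℝ}
    (hV : ∀ k, ContDiffAt ℝ ∞ (fun z => V z k) p) (hW : ∀ k, ContDiffAt ℝ ∞ (fun z => W z k) p) :
    ContDiffAt ℝ ∞ (pairing H w V W) p :=
  ContDiffAt.sum fun i _ => ContDiffAt.sum fun j _ =>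
    ((hE.smooth_metric_comp hp i j).mul (hV i)).mul (hW j)

theorem smooth_pd_map (α : Fin m) (k : Fin n) :
    ContDiffAt ℝ ∞ (fun z => pd α (fun z' => w z' k) z) p :=
  (smooth_coord (hE.smooth_map p hp) k).pd α

theorem smooth_covD {V : Coord m → Fin n → ℝ} (hV : ∀ k, ContDiffAt ℝ ∞ (fun z => V z k) p)
    (α : Fin m) (k : Fin n) : ContDiffAt ℝ ∞ (fun z => covD H w α V z k) p := by
  refine ((hV k).pd α).add (ContDiffAt.sum fun i _ => ContDiffAt.sum fun j _ => ?_)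
  refine ContDiffAt.mul (ContDiffAt.mul ?_ (hE.smooth_pd_map hp α i)) (hV j)
  exact (smooth_christoffel (hE.smooth_metric p hp) (hE.det_ne_zero p hp) k i j).comp p
    (hE.smooth_map p hp)

/-- The pull-back connection is compatible with the metric. -/
theorem pd_pairing {V W : Coord m → Fin n → ℝ}
    (hV : ∀ k, ContDiffAt ℝ ∞ (fun z => V z k) p) (hW : ∀ k, ContDiffAt ℝ ∞ (fun z => W z k) p)
    (α : Fin m) : pd α (pairing H w V W) p =
      pairing H w (covD H w α V) W p + pairing H w V (covD H w α W) p := by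
  have hH := hE.smooth_metric_comp hp
  have h1 : pd α (pairing H w V W) p = ∑ i, ∑ j, ((∑ k, (∑ l, H (w p) i l *
      christoffel H l k j (w p) + ∑ l, H (w p) j l * christoffel H l k i (w p)) *
        pd α (fun z => w z k) p) * V p i * W p j + H (w p) i j * pd α (fun z => V z i) p * W p j +
      H (w p) i j * V p i * pd α (fun z => W z j) p) := by
    change pd α (fun z => ∑ i, ∑ j, H (w z) i j * V z i * W z j) p = _
    rw [pd_sum _ fun i _ => ContDiffAt.sum fun j _ => ((hH i j).mul (hV i)).mul (hW j)]
    refine Finset.sum_congr rfl fun i _ => ?_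
    rw [pd_sum _ fun j _ => ((hH i j).mul (hV i)).mul (hW j)]
    refine Finset.sum_congr rfl fun j _ => ?_
    rw [pd_mul ((hH i j).mul (hV i)) (hW j), pd_mul (hH i j) (hV i),
      pd_comp (hE.smooth_metric p hp i j) (hE.smooth_map p hp)]
    simp only [pd_metric hE.symm (hE.det_ne_zero p hp)]
    ring
  rw [h1]
  simp only [pairing, covD, mul_add, add_mul, Finset.sum_add_distrib]
  -- By the chain rule and `pd_metric`, `∂_α (H ∘ w)` splits into two halves: this one is the
  -- `Γ`-term of `D_α W`, and `h3` is that of `D_α V`.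
  have h2 : ∑ i, ∑ j, (∑ k, (∑ l, H (w p) i l * christoffel H l k j (w p)) *
      pd α (fun z => w z k) p) * V p i * W p j = ∑ i, ∑ j, H (w p) i j * V p i *
        ∑ k, ∑ l, christoffel H j k l (w p) * pd α (fun z => w z k) p * W p l := by
    simp only [Finset.mul_sum, Finset.sum_mul]
    refine Finset.sum_congr rfl fun i _ => ?_
    conv_lhs => enter [2, j]; rw [Finset.sum_comm]
    rw [Finset.sum_comm]
    refine Finset.sum_congr rfl fun l _ => ?_
    rw [Finset.sum_comm]
    refine Finset.sum_congr rfl fun k _ => Finset.sum_congr rfl fun j _ => ?_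
    ring
  have h3 : ∑ i, ∑ j, (∑ k, (∑ l, H (w p) j l * christoffel H l k i (w p)) *
      pd α (fun z => w z k) p) * V p i * W p j = ∑ i, ∑ j, H (w p) i j *
        (∑ k, ∑ l, christoffel H i k l (w p) * pd α (fun z => w z k) p * V p l) * W p j := by
    simp only [Finset.mul_sum, Finset.sum_mul]
    rw [Finset.sum_comm]
    conv_rhs => rw [Finset.sum_comm]
    refine Finset.sum_congr rfl fun j _ => ?_
    conv_lhs => enter [2, j]; rw [Finset.sum_comm]
    rw [Finset.sum_comm]
    refine Finset.sum_congr rfl fun l _ => ?_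
    rw [Finset.sum_comm]
    refine Finset.sum_congr rfl fun k _ => Finset.sum_congr rfl fun i _ => ?_
    rw [hE.symm _ j l]
    ring
  rw [h2, h3]
  ring

/-- The pull-back connection is torsion free. -/
theorem covD_pd_symm (α β : Fin m) (k : Fin n) :
    covD H w α (fun z k => pd β (fun z' => w z' k) z) p k =
      covD H w β (fun z k => pd α (fun z' => w z' k) z) p k := by
  simp only [covD]
  congr 1
  · exact pd_comm (smooth_coord (hE.smooth_map p hp) k) α β
  · rw [Finset.sum_comm]
    refine Finset.sum_congr rfl fun i _ => Finset.sum_congr rfl fun j _ => ?_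
    rw [christoffel_symm hE.symm]
    ring

/-- Parseval's identity for the frame. -/
theorem pairing_eq_sum (V W : Coord m → Fin n → ℝ) : pairing H w V W p =
    ∑ a, pairing H w V (E a) p * pairing H w W (E a) p := by
  let P : Matrix (Fin n) (Fin n) ℝ := Matrix.of fun a i => E a p i
  have hS : (H (w p)).transpose = H (w p) := by ext i j; exact hE.symm _ _ _
  have vec : ∀ V W : Coord m → Fin n → ℝ, pairing H w V W p =
      dotProduct (V p) ((H (w p)).mulVec (W p)) := by
    intro V W
    simp only [pairing, dotProduct, Matrix.mulVec, Finset.mul_sum]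
    refine Finset.sum_congr rfl fun i _ => Finset.sum_congr rfl fun j _ => ?_
    ring
  have h1 : P * (H (w p) * P.transpose) = 1 := by
    ext a b
    rw [Matrix.one_apply, ← hE.orthonormal p hp a b, vec]
    rfl
  -- Orthonormality says `P H Pᵀ = 1`. There are as many frame vectors as dimensions, so `P` is
  -- square and the one-sided inverse is two-sided: this is completeness of the frame.
  have h2 : H (w p) * P.transpose * P = 1 := mul_eq_one_comm.1 h1
  have h3 : ∀ W : Coord m → Fin n → ℝ, ∀ a, pairing H w W (E a) p =
      (P.mulVec ((H (w p)).mulVec (W p))) a := by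
    intro W a
    rw [pairing_symm hE.symm, vec]
    rfl
  have h4 : ∀ x y : Fin n → ℝ, dotProduct (P.mulVec x) (P.mulVec y) =
      dotProduct x (P.transpose.mulVec (P.mulVec y)) := by
    intro x y
    rw [Matrix.dotProduct_mulVec x, Matrix.vecMul_transpose]
  calc pairing H w V W p = dotProduct (V p) ((H (w p)).mulVec (W p)) := vec _ _
    _ = dotProduct (V p) ((H (w p) * P.transpose * P).mulVec ((H (w p)).mulVec (W p))) := by
      rw [h2, Matrix.one_mulVec]
    _ = dotProduct ((H (w p)).mulVec (V p))
        (P.transpose.mulVec (P.mulVec ((H (w p)).mulVec (W p)))) := by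
      rw [← Matrix.mulVec_mulVec, ← Matrix.mulVec_mulVec, Matrix.dotProduct_mulVec (V p),
        ← Matrix.mulVec_transpose, hS]
    _ = _ := by
      rw [← h4]
      simp only [h3]
      rfl

/-- `⟨e_c, e_a⟩` is constant on the open set `U`, so its derivative vanishes; metric compatibility
then makes the connection form skew. -/
theorem conn_antisymm (c a : Fin n) (α : Fin m) :
    pairing H w (covD H w α (E c)) (E a) p = -pairing H w (covD H w α (E a)) (E c) p := by
  have h := hE.pd_pairing hp (hE.smooth_frame p hp c) (hE.smooth_frame p hp a) α
  rw [pd_congr (f' := fun _ => if c = a then 1 else 0), pd_const,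
    pairing_symm hE.symm (E c)] at h
  · linarith
  · filter_upwards [hE.eventually_mem hp] with z hz using hE.orthonormal z hz c a

/-- The rule from which all three structure equations follow: metric compatibility, then Parseval
for `⟨V, D_α e_c⟩`, then skewness of the connection form. -/
theorem pd_pairing_frame {V : Coord m → Fin n → ℝ} (hV : ∀ k, ContDiffAt ℝ ∞ (fun z => V z k) p)
    (α : Fin m) (c : Fin n) : pd α (pairing H w V (E c)) p =
      pairing H w (covD H w α V) (E c) p -
        ∑ a, pairing H w (covD H w α (E a)) (E c) p * pairing H w V (E a) p := by
  rw [hE.pd_pairing hp hV (hE.smooth_frame p hp c), hE.pairing_eq_sum hp V, sub_eq_add_neg,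
    ← Finset.sum_neg_distrib]
  congr 1
  refine Finset.sum_congr rfl fun a _ => ?_
  rw [hE.conn_antisymm hp c a]
  ring

end IsFrameAlong

end PullbackConnection

/-! ### The structure equations for `dq`, `F` and `δq`. -/

section FrameEquations

variable {m n : ℕ} {U : Set (Coord m)} {H : Coord n → Matrix (Fin n) (Fin n) ℝ}
  {w : Coord m → Coord n} {E : Fin n → Coord m → Fin n → ℝ} {p : Coord m}

/-- `q^c_β`, the components of `dw` in the frame `E`. -/
def frameDiff (H : Coord n → Matrix (Fin n) (Fin n) ℝ) (w : Coord m → Coord n)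
    (E : Fin n → Coord m → Fin n → ℝ) (c : Fin n) (β : Fin m) (p : Coord m) : ℝ :=
  pairing H w (fun z k => pd β (fun z' => w z' k) z) (E c) p

/-- `A^c_{a,α}`, the connection form of the frame `E`. -/
def frameConn (H : Coord n → Matrix (Fin n) (Fin n) ℝ) (w : Coord m → Coord n)
    (E : Fin n → Coord m → Fin n → ℝ) (c a : Fin n) (α : Fin m) (p : Coord m) : ℝ :=
  pairing H w (covD H w α (E a)) (E c) p

/-- `F^c_{a,αβ}`, the curvature of the pull-back connection in the frame `E`. -/
def frameCurv (H : Coord n → Matrix (Fin n) (Fin n) ℝ) (w : Coord m → Coord n)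
    (E : Fin n → Coord m → Fin n → ℝ) (c a : Fin n) (α β : Fin m) (p : Coord m) : ℝ :=
  pairing H w (fun z k => covD H w α (covD H w β (E a)) z k -
    covD H w β (covD H w α (E a)) z k) (E c) p

namespace IsFrameAlong

variable (hE : IsFrameAlong U H w E) (hp : p ∈ U)
include hE hp

theorem smooth_frameDiff (c : Fin n) (β : Fin m) : ContDiffAt ℝ ∞ (frameDiff H w E c β) p :=
  hE.smooth_pairing hp (hE.smooth_pd_map hp β) (hE.smooth_frame p hp c)

theorem smooth_frameConn (c a : Fin n) (α : Fin m) :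
    ContDiffAt ℝ ∞ (frameConn H w E c a α) p :=
  hE.smooth_pairing hp (hE.smooth_covD hp (hE.smooth_frame p hp a) α) (hE.smooth_frame p hp c)

/-- `dq^c = -A^c_b ∧ q^b`. -/
theorem extD_frameDiff (c : Fin n) (α β : Fin m) : extD (frameDiff H w E c) α β p =
    -∑ b, (frameConn H w E c b α p * frameDiff H w E b β p -
      frameConn H w E c b β p * frameDiff H w E b α p) := by
  have h : ∀ α β : Fin m, pd α (frameDiff H w E c β) p = _ := fun α β =>
    hE.pd_pairing_frame hp (hE.smooth_pd_map hp β) α c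
  have ht : covD H w α (fun z k => pd β (fun z' => w z' k) z) p =
      covD H w β (fun z k => pd α (fun z' => w z' k) z) p :=
    funext fun k => hE.covD_pd_symm hp α β k
  have ht' : pairing H w (covD H w α (fun z k => pd β (fun z' => w z' k) z)) (E c) p =
      pairing H w (covD H w β (fun z k => pd α (fun z' => w z' k) z)) (E c) p := by
    simp only [pairing, ht]
  rw [extD, h, h, ht', Finset.sum_sub_distrib]
  simp only [frameDiff, frameConn]
  ring

/-- The curvature is `dA + A ∧ A`. -/
theorem frameCurv_eq (c a : Fin n) (α β : Fin m) : frameCurv H w E c a α β p =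
    pd α (frameConn H w E c a β) p - pd β (frameConn H w E c a α) p +
      ∑ b, (frameConn H w E c b α p * frameConn H w E b a β p -
        frameConn H w E c b β p * frameConn H w E b a α p) := by
  have h : ∀ α β : Fin m, pd α (frameConn H w E c a β) p = _ := fun α β =>
    hE.pd_pairing_frame hp (hE.smooth_covD hp (hE.smooth_frame p hp a) β) α c
  rw [frameCurv, pairing_sub_left, h, h, Finset.sum_sub_distrib]
  simp only [frameConn]
  ring

/-- `δq^c = A^c_{a,α} G^{αβ} q^a_β` for a harmonic map. -/
theorem codiff₁_frameDiff {G : Coord m → Matrix (Fin m) (Fin m) ℝ}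
    (hG : ∀ i j, ContDiffAt ℝ ∞ (fun z => G z i j) p) (hdet : (G p).det ≠ 0)
    (hw : ∀ k, ∑ α, covD H w α (fun z k => sqrtDet G z *
      ∑ β, (G z)⁻¹ α β * pd β (fun z' => w z' k) z) p k = 0) (c : Fin n) :
    codiff₁ G (frameDiff H w E c) p =
      ∑ a, ∑ α, ∑ β, frameConn H w E c a α p * (G p)⁻¹ α β * frameDiff H w E a β p := by
  have hs := sqrtDet_pos hdet
  -- The weighted gradient, with `√|G|` kept inside: its pairing with `e_c` is what the divergence
  -- in `codiff₁` differentiates, and `∑ D_α V_α` is the left side of `hw`. No Christoffel symbols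
  -- of `G` are needed.
  let V : Fin m → Coord m → Fin n → ℝ := fun α z k => sqrtDet G z *
      ∑ β, (G z)⁻¹ α β * pd β (fun z' => w z' k) z
  have hV : ∀ α k, ContDiffAt ℝ ∞ (fun z => V α z k) p := fun α k =>
    (smooth_sqrtDet hG hdet).mul (ContDiffAt.sum fun β _ =>
      (smooth_inv hG hdet α β).mul (hE.smooth_pd_map hp β k))
  have hVp : ∀ a α z, pairing H w (V α) (E a) z =
      sqrtDet G z * ∑ β, (G z)⁻¹ α β * frameDiff H w E a β z := by
    intro a α z
    rw [pairing_mul_left, pairing_sum_left]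
    simp only [pairing_mul_left (fun z => (G z)⁻¹ α _)]
    rfl
  have h1 : ∑ α, pairing H w (covD H w α (V α)) (E c) p = 0 := by
    rw [← pairing_sum_left]
    simp only [pairing]
    refine Finset.sum_eq_zero fun i _ => Finset.sum_eq_zero fun j _ => ?_
    rw [show ∑ α, covD H w α (V α) p i = 0 from hw i]
    ring
  have h2 : ∀ α, pd α (fun z => sqrtDet G z * ∑ β, (G z)⁻¹ α β * frameDiff H w E c β z) p =
      pairing H w (covD H w α (V α)) (E c) p - ∑ a, frameConn H w E c a α p *
        (sqrtDet G p * ∑ β, (G p)⁻¹ α β * frameDiff H w E a β p) := by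
    intro α
    have := hE.pd_pairing_frame hp (hV α) α c
    simp only [hVp] at this
    exact (pd_congr (Filter.Eventually.of_forall fun z => (hVp c α z).symm) α).trans this
  rw [codiff₁]
  simp only [h2]
  rw [Finset.sum_sub_distrib, h1, zero_sub, mul_neg, neg_neg, Finset.sum_comm, Finset.mul_sum]
  refine Finset.sum_congr rfl fun a _ => ?_
  rw [Finset.mul_sum]
  refine Finset.sum_congr rfl fun α _ => ?_
  rw [Finset.mul_sum, Finset.mul_sum, Finset.mul_sum]
  refine Finset.sum_congr rfl fun β _ => ?_
  field_simp

end IsFrameAlong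

end FrameEquations

/-! ### From the first-order equations to the wave equation. -/

section HodgeLaplacian

variable {m n : ℕ} {G : Coord m → Matrix (Fin m) (Fin m) ℝ} {p : Coord m}

/-- If `δq = A·q`, `dq = -A ∧ q` and `F = dA + A ∧ A`, then
`(□q)_γ = F_{γα} q^α + A_α A^α q_γ + (∇^α A)_α q_γ + 2 A^α (∇_α q)_γ`. -/
theorem hodgeLaplacian_eq (hG : ∀ i j, ContDiffAt ℝ ∞ (fun z => G z i j) p)
    (hsymm : ∀ z i j, G z i j = G z j i) (hdet : (G p).det ≠ 0)
    {q : Fin n → Fin m → Coord m → ℝ} {A : Fin n → Fin n → Fin m → Coord m → ℝ}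
    (hq : ∀ a α, ContDiffAt ℝ ∞ (q a α) p) (hA : ∀ c a α, ContDiffAt ℝ ∞ (A c a α) p)
    (hδ : ∀ c, ∀ᶠ z in 𝓝 p,
      codiff₁ G (q c) z = ∑ a, ∑ α, ∑ β, A c a α z * (G z)⁻¹ α β * q a β z)
    (hd : ∀ c α β, ∀ᶠ z in 𝓝 p,
      extD (q c) α β z = -∑ b, (A c b α z * q b β z - A c b β z * q b α z))
    {F : Fin n → Fin n → Fin m → Fin m → ℝ}
    (hF : ∀ c a α β, F c a α β = pd α (A c a β) p - pd β (A c a α) p +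
      ∑ b, (A c b α p * A b a β p - A c b β p * A b a α p)) (c : Fin n) (γ : Fin m) :
    hodgeLaplacian G (q c) γ p =
      (∑ a, ∑ α, ∑ β, F c a γ α * ((G p)⁻¹ α β * q a β p)) +
      (∑ b, ∑ a, ∑ α, ∑ β, A c b α p * ((G p)⁻¹ α β * A b a β p) * q a γ p) +
      (∑ a, (∑ α, ∑ β, (G p)⁻¹ α β * nabla₁ G (A c a) β α p) * q a γ p) +
      2 * ∑ a, ∑ α, ∑ β, ((G p)⁻¹ α β * A c a β p) * nabla₁ G (q a) α γ p := by
  have hF' : ∀ a α, F c a γ α = nabla₁ G (A c a) γ α p - nabla₁ G (A c a) α γ p +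
      ∑ b, (A c b γ p * A b a α p - A c b α p * A b a γ p) := by
    intro a α
    rw [hF, ← extD_eq hsymm (A c a) γ α p]
    rfl
  -- The equation for `dq`, read as a rule for exchanging the two indices of `∇q`.
  have hn : ∀ a β, nabla₁ G (q a) γ β p = nabla₁ G (q a) β γ p -
      ∑ b, (A a b γ p * q b β p - A a b β p * q b γ p) := by
    intro a β
    have h := (hd a γ β).self_of_nhds
    rw [extD_eq hsymm] at h
    linarith
  -- The trace of `∇q` is `-δq`, hence given by the first-order equation.
  have htr : ∀ b, ∑ i, ∑ l, (G p)⁻¹ i l * nabla₁ G (q b) l i p =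
      -∑ a, ∑ α, ∑ β, A b a α p * (G p)⁻¹ α β * q a β p := by
    intro b
    rw [← (hδ b).self_of_nhds, codiff₁_eq hG hsymm hdet (hq b), neg_neg, Finset.sum_comm]
    refine Finset.sum_congr rfl fun i _ => Finset.sum_congr rfl fun l _ => ?_
    rw [inv_symm hsymm]
  have hdδ : pd γ (codiff₁ G (q c)) p = ∑ a, ∑ α, ∑ β, (G p)⁻¹ α β *
      (nabla₁ G (A c a) γ α p * q a β p + A c a α p * nabla₁ G (q a) γ β p) := by
    rw [pd_congr (hδ c), pd_sum _ fun a _ => ContDiffAt.sum fun α _ => ContDiffAt.sum fun β _ =>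
      ((hA c a α).mul (smooth_inv hG hdet α β)).mul (hq a β)]
    exact Finset.sum_congr rfl fun a _ => pd_inv_pairing hG hsymm hdet (hA c a) (hq a) γ
  have hδd : codiff₂ G (extD (q c)) γ p = -∑ i, ∑ l, (G p)⁻¹ i l *
      ∑ b, (nabla₁ G (A c b) l γ p * q b i p + A c b γ p * nabla₁ G (q b) l i p -
        (nabla₁ G (A c b) l i p * q b γ p + A c b i p * nabla₁ G (q b) l γ p)) := by
    rw [codiff₂]
    congr 1
    refine Finset.sum_congr rfl fun i _ => Finset.sum_congr rfl fun l _ => ?_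
    congr 1
    rw [nabla₂_congr (B' := fun i j z => ∑ b, (A c b j z * q b i z - A c b i z * q b j z)),
      nabla₂_sum _ fun b _ i j => ((hA c b j).mul (hq b i)).sub ((hA c b i).mul (hq b j))]
    · exact Finset.sum_congr rfl fun b _ => nabla₂_wedge (hA c b) (hq b) l i γ
    · intro i j
      filter_upwards [hd c i j] with z hz
      rw [hz, ← Finset.sum_neg_distrib]
      exact Finset.sum_congr rfl fun b _ => by ring
  have hδd' : codiff₂ G (extD (q c)) γ p =
      -(∑ a, ∑ α, ∑ β, (G p)⁻¹ α β * nabla₁ G (A c a) α γ p * q a β p) +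
      (∑ b, A c b γ p * ∑ a, ∑ α, ∑ β, A b a α p * (G p)⁻¹ α β * q a β p) +
      (∑ a, (∑ α, ∑ β, (G p)⁻¹ α β * nabla₁ G (A c a) β α p) * q a γ p) +
      ∑ a, ∑ α, ∑ β, ((G p)⁻¹ α β * A c a β p) * nabla₁ G (q a) α γ p := by
    have e : ∀ T : Fin m → Fin m → Fin n → ℝ, ∑ i, ∑ l, (G p)⁻¹ i l * ∑ b, T i l b =
        ∑ b, ∑ i, ∑ l, (G p)⁻¹ i l * T i l b := by
      intro T
      simp only [Finset.mul_sum]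
      rw [Finset.sum_comm]
      conv_lhs => enter [2, l]; rw [Finset.sum_comm]
      rw [Finset.sum_comm]
      exact Finset.sum_congr rfl fun b _ => Finset.sum_comm
    rw [hδd, e, ← Finset.sum_neg_distrib, ← Finset.sum_neg_distrib, ← Finset.sum_add_distrib,
      ← Finset.sum_add_distrib, ← Finset.sum_add_distrib]
    refine Finset.sum_congr rfl fun a _ => ?_
    have ht := htr a
    have e4 : ∑ i, ∑ l, (G p)⁻¹ i l * (A c a γ p * nabla₁ G (q a) l i p) =
        -(A c a γ p * ∑ b, ∑ α, ∑ β, A a b α p * (G p)⁻¹ α β * q b β p) := by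
      rw [← mul_neg, ← ht]
      simp only [Finset.mul_sum]
      exact Finset.sum_congr rfl fun i _ => Finset.sum_congr rfl fun l _ => by ring
    have e3 : ∑ i, ∑ l, (G p)⁻¹ i l * (nabla₁ G (A c a) l γ p * q a i p) =
        ∑ α, ∑ β, (G p)⁻¹ α β * nabla₁ G (A c a) α γ p * q a β p := by
      rw [Finset.sum_comm]
      refine Finset.sum_congr rfl fun i _ => Finset.sum_congr rfl fun l _ => ?_
      rw [inv_symm hsymm]; ring
    have e5 : ∑ i, ∑ l, (G p)⁻¹ i l * (nabla₁ G (A c a) l i p * q a γ p) =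
        (∑ α, ∑ β, (G p)⁻¹ α β * nabla₁ G (A c a) β α p) * q a γ p := by
      simp only [Finset.sum_mul, mul_assoc]
    have e6 : ∑ i, ∑ l, (G p)⁻¹ i l * (A c a i p * nabla₁ G (q a) l γ p) =
        ∑ α, ∑ β, ((G p)⁻¹ α β * A c a β p) * nabla₁ G (q a) α γ p := by
      rw [Finset.sum_comm]
      refine Finset.sum_congr rfl fun i _ => Finset.sum_congr rfl fun l _ => ?_
      rw [inv_symm hsymm]; ring
    simp only [mul_sub, mul_add, Finset.sum_add_distrib, Finset.sum_sub_distrib, e3, e4, e5, e6]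
    ring
  -- Inserting `hn` into `A^α ∇_γ q_α` yields the second copy of `A^α ∇_α q_γ`, the term `A_α A^α
  -- q_γ`, and `-A^α A_γ q_α`, which is half of the commutator in `F`; the other half is in `hδd'`.
  have hdδ' : pd γ (codiff₁ G (q c)) p =
      (∑ a, ∑ α, ∑ β, (G p)⁻¹ α β * nabla₁ G (A c a) γ α p * q a β p) +
      (∑ a, ∑ α, ∑ β, ((G p)⁻¹ α β * A c a β p) * nabla₁ G (q a) α γ p) -
      (∑ a, ∑ α, ∑ β, (∑ b, A c b α p * A b a γ p) * ((G p)⁻¹ α β * q a β p)) +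
      ∑ b, ∑ a, ∑ α, ∑ β, A c b α p * ((G p)⁻¹ α β * A b a β p) * q a γ p := by
    have e1 : ∑ a, ∑ α, ∑ β, (G p)⁻¹ α β * (A c a α p * nabla₁ G (q a) β γ p) =
        ∑ a, ∑ α, ∑ β, ((G p)⁻¹ α β * A c a β p) * nabla₁ G (q a) α γ p := by
      refine Finset.sum_congr rfl fun a _ => ?_
      rw [Finset.sum_comm]
      refine Finset.sum_congr rfl fun i _ => Finset.sum_congr rfl fun l _ => ?_
      rw [inv_symm hsymm]; ring
    have e2 : ∑ a, ∑ α, ∑ β, (G p)⁻¹ α β * (A c a α p * ∑ b, A a b γ p * q b β p) =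
        ∑ a, ∑ α, ∑ β, (∑ b, A c b α p * A b a γ p) * ((G p)⁻¹ α β * q a β p) := by
      have : ∀ α β, ∑ a, (G p)⁻¹ α β * (A c a α p * ∑ b, A a b γ p * q b β p) =
          ∑ a, (∑ b, A c b α p * A b a γ p) * ((G p)⁻¹ α β * q a β p) := by
        intro α β
        simp only [Finset.mul_sum, Finset.sum_mul]
        rw [Finset.sum_comm]
        refine Finset.sum_congr rfl fun a _ => Finset.sum_congr rfl fun b _ => ?_
        ring
      rw [Finset.sum_comm]
      conv_lhs => enter [2, α]; rw [Finset.sum_comm]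
      conv_rhs => rw [Finset.sum_comm]
      conv_rhs => enter [2, α]; rw [Finset.sum_comm]
      simp only [this]
    have e3 : ∑ a, ∑ α, ∑ β, (G p)⁻¹ α β * (A c a α p * ∑ b, A a b β p * q b γ p) =
        ∑ b, ∑ a, ∑ α, ∑ β, A c b α p * ((G p)⁻¹ α β * A b a β p) * q a γ p := by
      refine Finset.sum_congr rfl fun b _ => ?_
      simp only [Finset.mul_sum]
      conv_lhs => enter [2, α]; rw [Finset.sum_comm]
      rw [Finset.sum_comm]
      refine Finset.sum_congr rfl fun a _ => Finset.sum_congr rfl fun α _ =>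
        Finset.sum_congr rfl fun β _ => ?_
      ring
    rw [hdδ, ← e1, ← e2, ← e3]
    simp only [hn, Finset.sum_sub_distrib, mul_sub, mul_add, Finset.sum_add_distrib, mul_assoc]
    ring
  have hFq : ∑ a, ∑ α, ∑ β, F c a γ α * ((G p)⁻¹ α β * q a β p) =
      (∑ a, ∑ α, ∑ β, (G p)⁻¹ α β * nabla₁ G (A c a) γ α p * q a β p) -
      (∑ a, ∑ α, ∑ β, (G p)⁻¹ α β * nabla₁ G (A c a) α γ p * q a β p) +
      (∑ b, A c b γ p * ∑ a, ∑ α, ∑ β, A b a α p * (G p)⁻¹ α β * q a β p) -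
      (∑ a, ∑ α, ∑ β, (∑ b, A c b α p * A b a γ p) * ((G p)⁻¹ α β * q a β p)) := by
    have e1 : ∑ b, A c b γ p * ∑ a, ∑ α, ∑ β, A b a α p * (G p)⁻¹ α β * q a β p =
        ∑ a, ∑ α, ∑ β, (∑ b, A c b γ p * A b a α p) * ((G p)⁻¹ α β * q a β p) := by
      simp only [Finset.mul_sum, Finset.sum_mul]
      rw [Finset.sum_comm]
      refine Finset.sum_congr rfl fun a _ => ?_
      rw [Finset.sum_comm]
      refine Finset.sum_congr rfl fun α _ => ?_
      rw [Finset.sum_comm]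
      refine Finset.sum_congr rfl fun β _ => Finset.sum_congr rfl fun b _ => ?_
      ring
    rw [e1]
    simp only [← Finset.sum_sub_distrib, ← Finset.sum_add_distrib]
    refine Finset.sum_congr rfl fun a _ => Finset.sum_congr rfl fun α _ =>
      Finset.sum_congr rfl fun β _ => ?_
    rw [hF', Finset.sum_sub_distrib]
    ring
  rw [hodgeLaplacian, hdδ', hδd', hFq]
  ring

end HodgeLaplacian

/-! ### Tangent vectors and the Riemannian metric in a chart. -/

section ChartCalculus

variable {m : ℕ} {X : Type*} [TopologicalSpace X] [ChartedSpace (Coord m) X]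
  {φ : OpenPartialHomeomorph X (Coord m)}

theorem mdifferentiableAt_chart (hφ : φ ∈ IsManifold.maximalAtlas (𝓡 m) ∞ X) {x : X}
    (hx : x ∈ φ.source) : MDifferentiableAt (𝓡 m) (𝓡 m) φ x :=
  (contMDiffAt_of_mem_maximalAtlas hφ hx).mdifferentiableAt (by simp)

theorem mdifferentiableAt_chart_symm (hφ : φ ∈ IsManifold.maximalAtlas (𝓡 m) ∞ X) {y : Coord m}
    (hy : y ∈ φ.target) : MDifferentiableAt (𝓡 m) (𝓡 m) φ.symm y :=
  (contMDiffAt_symm_of_mem_maximalAtlas hφ hy).mdifferentiableAt (by simp)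

theorem mfderiv_symm_eq_sum (y : Coord m) (v : Coord m) :
    mfderiv (𝓡 m) (𝓡 m) φ.symm y v = ∑ i, v i • coordVec φ i y := by
  conv_lhs => rw [eq_sum_single v]
  exact (map_sum (mfderiv (𝓡 m) (𝓡 m) φ.symm y) _ _).trans
    (Finset.sum_congr rfl fun i _ => map_smul (mfderiv (𝓡 m) (𝓡 m) φ.symm y) _ _)

/-- The components of the tangent vector `v` in the chart `φ`. -/
def comps (φ : OpenPartialHomeomorph X (Coord m)) {x : X} (v : TangentSpace (𝓡 m) x) : Coord m :=
  mfderiv (𝓡 m) (𝓡 m) φ x v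

theorem mfderiv_chart_mfderiv_symm (hφ : φ ∈ IsManifold.maximalAtlas (𝓡 m) ∞ X) {y : Coord m}
    (hy : y ∈ φ.target) (v : Coord m) :
    mfderiv (𝓡 m) (𝓡 m) φ (φ.symm y) (mfderiv (𝓡 m) (𝓡 m) φ.symm y v) = v := by
  have h1 := mfderiv_comp y (mdifferentiableAt_chart hφ (φ.map_target hy))
    (mdifferentiableAt_chart_symm hφ hy)
  have h2 : φ ∘ φ.symm =ᶠ[𝓝 y] id := φ.eventually_right_inverse hy
  rw [h2.mfderiv_eq, mfderiv_id] at h1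
  exact (DFunLike.congr_fun h1 v).symm

theorem mfderiv_symm_mfderiv_chart (hφ : φ ∈ IsManifold.maximalAtlas (𝓡 m) ∞ X) {y : Coord m}
    (hy : y ∈ φ.target) (v : TangentSpace (𝓡 m) (φ.symm y)) :
    mfderiv (𝓡 m) (𝓡 m) φ.symm y (mfderiv (𝓡 m) (𝓡 m) φ (φ.symm y) v) = v := by
  have hx := φ.map_target hy
  have hyy : φ (φ.symm y) = y := φ.right_inv hy
  have h1 := mfderiv_comp_of_eq (mdifferentiableAt_chart_symm hφ hy)
    (mdifferentiableAt_chart hφ hx) hyy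
  have h2 : φ.symm ∘ φ =ᶠ[𝓝 (φ.symm y)] id := φ.eventually_left_inverse hx
  rw [h2.mfderiv_eq, mfderiv_id] at h1
  have h3 : v = mfderiv (𝓡 m) (𝓡 m) φ.symm (φ (φ.symm y))
    (mfderiv (𝓡 m) (𝓡 m) φ (φ.symm y) v) := DFunLike.congr_fun h1 v
  -- The points `φ (φ.symm y)` and `y` are only propositionally equal, so the two differentials are
  -- compared on vectors of the model space.
  have key : ∀ z, z = y → ∀ c : Coord m, (mfderiv (𝓡 m) (𝓡 m) φ.symm z c : Coord m) =
      (mfderiv (𝓡 m) (𝓡 m) φ.symm y c : Coord m) := by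
    rintro _ rfl _; rfl
  exact (key _ hyy _).symm.trans h3.symm

variable [IsManifold (𝓡 m) ∞ X]

theorem metricCoeff_symm (g : Metric m X) (φ : OpenPartialHomeomorph X (Coord m)) (y : Coord m)
    (i j : Fin m) : metricCoeff g φ y i j = metricCoeff g φ y j i := g.symm _ _ _

/-- `∂_i` is the tangent map of `φ.symm` applied to a constant section; on the open target,
derivatives within the set are ordinary ones. -/
theorem smooth_coordVec (hφ : φ ∈ IsManifold.maximalAtlas (𝓡 m) ∞ X) (i : Fin m) {y : Coord m}
    (hy : y ∈ φ.target) : ContMDiffAt (𝓡 m) (𝓡 m).tangent ∞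
      (fun z => (⟨φ.symm z, coordVec φ i z⟩ : TangentBundle (𝓡 m) X)) y := by
  have hs := contMDiffOn_symm_of_mem_maximalAtlas hφ
  have h1 := hs.contMDiffOn_tangentMapWithin (m := ∞) le_rfl φ.open_target.uniqueMDiffOn
  have h2 : ContMDiffAt (𝓡 m) (𝓡 m).tangent ∞
      (fun z : Coord m => (⟨z, (EuclideanSpace.single i 1 : Coord m)⟩ :
        TangentBundle (𝓡 m) (Coord m))) y := by
    have := (contMDiffWithinAt_vectorSpace_iff_contDiffWithinAt (𝕜 := ℝ) (n := ∞)
      (s := Set.univ) (x := y)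
      (V := fun _ : Coord m => (EuclideanSpace.single i 1 : Coord m))).2 contDiffWithinAt_const
    exact contMDiffWithinAt_univ.1 this
  have hmem : ∀ᶠ z in 𝓝 y, z ∈ φ.target := φ.open_target.mem_nhds hy
  have h3 := (h1 ⟨y, (EuclideanSpace.single i 1 : Coord m)⟩ hy).comp y
    (h2.contMDiffWithinAt (s := φ.target)) (fun z hz => hz)
  refine (h3.contMDiffAt hmem).congr_of_eventuallyEq ?_
  filter_upwards [hmem] with z hz
  simp only [Function.comp, tangentMapWithin, coordVec,
    mfderivWithin_of_isOpen φ.open_target hz]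

theorem smooth_inner {Y : Type*} {EY HY : Type*} [NormedAddCommGroup EY] [NormedSpace ℝ EY]
    [TopologicalSpace HY] {IY : ModelWithCorners ℝ EY HY} [TopologicalSpace Y] [ChartedSpace HY Y]
    (g : Metric m X) {b : Y → X} {v w : ∀ y, TangentSpace (𝓡 m) (b y)} {y : Y}
    (hv : ContMDiffAt IY (𝓡 m).tangent ∞ (fun z => (⟨b z, v z⟩ : TangentBundle (𝓡 m) X)) y)
    (hw : ContMDiffAt IY (𝓡 m).tangent ∞ (fun z => (⟨b z, w z⟩ : TangentBundle (𝓡 m) X)) y) :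
    ContMDiffAt IY 𝓘(ℝ, ℝ) ∞ (fun z => g.inner (b z) (v z) (w z)) y := by
  -- Installing `g` as the fibrewise inner product reduces the claim to smoothness of inner products
  -- of smooth sections.
  let : RiemannianBundle (fun x : X => TangentSpace (𝓡 m) x) := ⟨g.toRiemannianMetric⟩
  exact ContMDiffAt.inner_bundle (IB := 𝓡 m) (F := Coord m)
    (E := fun x : X => TangentSpace (𝓡 m) x) hv hw

theorem smooth_metricCoeff (g : Metric m X) (hφ : φ ∈ IsManifold.maximalAtlas (𝓡 m) ∞ X)
    {y : Coord m} (hy : y ∈ φ.target) (i j : Fin m) :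
    ContDiffAt ℝ ∞ (fun z => metricCoeff g φ z i j) y :=
  (smooth_inner g (smooth_coordVec hφ i hy) (smooth_coordVec hφ j hy)).contDiffAt

theorem inner_mfderiv_symm (g : Metric m X) (y v w : Coord m) :
    g.inner (φ.symm y) (mfderiv (𝓡 m) (𝓡 m) φ.symm y v) (mfderiv (𝓡 m) (𝓡 m) φ.symm y w) =
      ∑ i, ∑ j, metricCoeff g φ y i j * v i * w j := by
  rw [mfderiv_symm_eq_sum, mfderiv_symm_eq_sum]
  simp only [map_sum, map_smul, sum_apply, smul_apply, smul_eq_mul, Finset.mul_sum]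
  rw [Finset.sum_comm]
  refine Finset.sum_congr rfl fun i _ => Finset.sum_congr rfl fun j _ => ?_
  simp only [metricCoeff, Matrix.of_apply]
  ring

/-- The Riemannian metric in coordinates. -/
theorem inner_eq_sum (g : Metric m X) (hφ : φ ∈ IsManifold.maximalAtlas (𝓡 m) ∞ X) {x : X}
    (hx : x ∈ φ.source) (v w : TangentSpace (𝓡 m) x) :
    g.inner x v w = ∑ i, ∑ j, metricCoeff g φ (φ x) i j *
      comps φ v i * comps φ w j := by
  obtain ⟨y, hy, rfl⟩ : ∃ y ∈ φ.target, φ.symm y = x := ⟨φ x, φ.map_source hx, φ.left_inv hx⟩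
  rw [φ.right_inv hy, ← inner_mfderiv_symm]
  simp only [comps]
  rw [mfderiv_symm_mfderiv_chart hφ hy,
    mfderiv_symm_mfderiv_chart hφ hy]

/-- A kernel vector of the matrix would give a nonzero tangent vector of `g`-length zero. -/
theorem det_metricCoeff_ne_zero (g : Metric m X) (hφ : φ ∈ IsManifold.maximalAtlas (𝓡 m) ∞ X)
    {y : Coord m} (hy : y ∈ φ.target) : (metricCoeff g φ y).det ≠ 0 := by
  intro h0
  obtain ⟨v, hv, hv0⟩ := Matrix.exists_mulVec_eq_zero_iff.2 h0
  have h1 := inner_mfderiv_symm (φ := φ) g y (WithLp.toLp 2 v) (WithLp.toLp 2 v)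
  have h2 : ∑ i, ∑ j, metricCoeff g φ y i j * v i * v j = 0 := by
    have : ∀ i, ∑ j, metricCoeff g φ y i j * v j = 0 := fun i => congrFun hv0 i
    refine Finset.sum_eq_zero fun i _ => ?_
    rw [← mul_zero (v i), ← this i, Finset.mul_sum]
    exact Finset.sum_congr rfl fun j _ => by ring
  have h3 : mfderiv (𝓡 m) (𝓡 m) φ.symm y (WithLp.toLp 2 v) ≠ 0 := by
    intro h
    have h4 := mfderiv_chart_mfderiv_symm hφ hy (WithLp.toLp 2 v)
    rw [h, map_zero] at h4
    exact hv ((WithLp.toLp_eq_zero 2).1 h4.symm)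
  have h5 := g.pos _ _ h3
  rw [h1] at h5
  exact absurd h2 h5.ne'

end ChartCalculus

/-! ### Coordinates on `ℝ × M` and the Lorentzian metric. -/

section Spacetime

variable {m : ℕ} {X : Type*} [TopologicalSpace X] [ChartedSpace (Coord m) X]
  {φ : OpenPartialHomeomorph X (Coord m)}

theorem smooth_spacePart : ContDiff ℝ ∞ (spacePart (d := m)) := by
  refine contDiff_euclidean.2 fun i => ?_
  exact (EuclideanSpace.proj i.succ : Coord (m + 1) →L[ℝ] ℝ).contDiff

theorem smooth_spacetimePoint (hφ : φ ∈ IsManifold.maximalAtlas (𝓡 m) ∞ X) {p : Coord (m + 1)}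
    (hp : spacePart p ∈ φ.target) :
    ContMDiffAt (𝓡 (m + 1)) (𝓘(ℝ, ℝ).prod (𝓡 m)) ∞ (spacetimePoint φ) p := by
  refine ContMDiffAt.prodMk ?_ ?_
  · exact (EuclideanSpace.proj 0 : Coord (m + 1) →L[ℝ] ℝ).contDiff.contMDiff.contMDiffAt
  · exact (contMDiffAt_symm_of_mem_maximalAtlas hφ hp).comp p
      smooth_spacePart.contMDiff.contMDiffAt

theorem smooth_comps [IsManifold (𝓡 m) ∞ X] {Y : Type*} {EY HY : Type*} [NormedAddCommGroup EY]
    [NormedSpace ℝ EY] [TopologicalSpace HY] {IY : ModelWithCorners ℝ EY HY} [TopologicalSpace Y]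
    [ChartedSpace HY Y] (hφ : φ ∈ IsManifold.maximalAtlas (𝓡 m) ∞ X) {b : Y → X}
    {v : ∀ y, TangentSpace (𝓡 m) (b y)} {y : Y}
    (hv : ContMDiffAt IY (𝓡 m).tangent ∞ (fun z => (⟨b z, v z⟩ : TangentBundle (𝓡 m) X)) y)
    (hb : b y ∈ φ.source) : ContMDiffAt IY 𝓘(ℝ, Coord m) ∞ (fun z => comps φ (v z)) y := by
  have hpre : IsOpen (TotalSpace.proj (F := Coord m) (E := fun x : X => TangentSpace (𝓡 m) x) ⁻¹'
      φ.source) := φ.open_source.preimage (FiberBundle.continuous_proj _ _)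
  have hmem : ∀ᶠ z in 𝓝 y, b z ∈ φ.source :=
    hv.continuousAt.eventually (hpre.mem_nhds hb)
  have h1 := ((contMDiffOn_of_mem_maximalAtlas hφ).contMDiffOn_tangentMapWithin (m := ∞) le_rfl
    φ.open_source.uniqueMDiffOn).contMDiffAt
      (hpre.mem_nhds (x := (⟨b y, v y⟩ : TangentBundle (𝓡 m) X)) hb)
  have h2 := (contMDiff_snd_tangentBundle_modelSpace (n := ∞) (Coord m) (𝓡 m)).contMDiffAt.comp y
    (h1.comp y hv)
  refine h2.congr_of_eventuallyEq ?_
  filter_upwards [hmem] with z hz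
  simp only [Function.comp, tangentMapWithin, comps, mfderivWithin_of_isOpen φ.open_source hz]
  rfl

section Eta

variable [IsManifold (𝓡 m) ∞ X]

theorem eta_symm (g : Metric m X) (φ : OpenPartialHomeomorph X (Coord m)) (p : Coord (m + 1))
    (α β : Fin (m + 1)) : eta g φ p α β = eta g φ p β α := by
  refine Fin.cases ?_ (fun i => ?_) α <;> refine Fin.cases ?_ (fun j => ?_) β
  · rfl
  · rfl
  · rfl
  · exact metricCoeff_symm g φ _ i j

theorem smooth_eta (g : Metric m X) (hφ : φ ∈ IsManifold.maximalAtlas (𝓡 m) ∞ X)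
    {p : Coord (m + 1)} (hp : spacePart p ∈ φ.target) (α β : Fin (m + 1)) :
    ContDiffAt ℝ ∞ (fun z => eta g φ z α β) p := by
  refine Fin.cases ?_ (fun i => ?_) α <;> refine Fin.cases ?_ (fun j => ?_) β
  · exact contDiffAt_const
  · exact contDiffAt_const
  · exact contDiffAt_const
  · exact (smooth_metricCoeff g hφ hp i j).comp p smooth_spacePart.contDiffAt

/-- Laplace expansion along the time row `(-1, 0, …, 0)`; nondegeneracy of `η` thus reduces to that
of `g`. -/
theorem det_eta (g : Metric m X) (φ : OpenPartialHomeomorph X (Coord m)) (p : Coord (m + 1)) :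
    (eta g φ p).det = -(metricCoeff g φ (spacePart p)).det := by
  have h0 : ∀ j : Fin m, eta g φ p 0 j.succ = 0 := fun j => rfl
  have h1 : eta g φ p 0 0 = -1 := rfl
  have h2 : (eta g φ p).submatrix Fin.succ (Fin.succAbove 0) = metricCoeff g φ (spacePart p) := by
    ext i j
    rfl
  rw [Matrix.det_succ_row_zero, Fin.sum_univ_succ]
  simp only [h0, h1, h2]
  simp

theorem det_eta_ne_zero (g : Metric m X) (hφ : φ ∈ IsManifold.maximalAtlas (𝓡 m) ∞ X)
    {p : Coord (m + 1)} (hp : spacePart p ∈ φ.target) : (eta g φ p).det ≠ 0 := by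
  rw [det_eta]
  exact neg_ne_zero.2 (det_metricCoeff_ne_zero g hφ hp)

end Eta

end Spacetime

/-! ### The map `u` and its frame in coordinates. -/

section Maps

variable {d n : ℕ}
  {M : Type*} [TopologicalSpace M] [ChartedSpace (Coord d) M]
  {N : Type*} [TopologicalSpace N]
  {φ : OpenPartialHomeomorph M (Coord d)} {κ : OpenPartialHomeomorph N (Coord n)}
  {u : ℝ × M → N}

theorem isOpen_chartDomain (hφ : φ ∈ IsManifold.maximalAtlas (𝓡 d) ∞ M) (hu : Continuous u) :
    IsOpen (chartDomain φ κ u) := by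
  refine isOpen_iff_mem_nhds.2 fun p hp => ?_
  have h1 : ∀ᶠ z in 𝓝 p, spacePart z ∈ φ.target :=
    smooth_spacePart.continuous.continuousAt.eventually (φ.open_target.mem_nhds hp.1)
  have h2 : ∀ᶠ z in 𝓝 p, u (spacetimePoint φ z) ∈ κ.source :=
    (hu.continuousAt.comp (smooth_spacetimePoint hφ hp.1).continuousAt).eventually
      (κ.open_source.mem_nhds hp.2)
  exact h1.and h2

variable [ChartedSpace (Coord n) N]
  (hu : ContMDiff (𝓘(ℝ, ℝ).prod (𝓡 d)) (𝓡 n) ∞ u)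
  (hφ : φ ∈ IsManifold.maximalAtlas (𝓡 d) ∞ M) (hκ : κ ∈ IsManifold.maximalAtlas (𝓡 n) ∞ N)
  {p : Coord (d + 1)} (hp : p ∈ chartDomain φ κ u)
include hu hφ hκ hp

theorem smooth_localRep : ContDiffAt ℝ ∞ (localRep φ κ u) p :=
  ((contMDiffAt_of_mem_maximalAtlas hκ hp.2).comp p
    (hu.contMDiffAt.comp p (smooth_spacetimePoint hφ hp.1))).contDiffAt

/-- Chain rule for `κ ∘ u ∘ (t, φ)⁻¹`; it links the invariantly defined `q` to partial derivatives
of `localRep`. -/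
theorem comps_mfderiv (α : Fin (d + 1)) (k : Fin n) :
    comps κ (mfderiv (𝓘(ℝ, ℝ).prod (𝓡 d)) (𝓡 n) u (spacetimePoint φ p) (spacetimeVec φ α p)) k =
      pd α (fun z => localRep φ κ u z k) p := by
  have hs := (smooth_spacetimePoint hφ hp.1).mdifferentiableAt (by simp)
  have hu' := (hu.contMDiffAt (x := spacetimePoint φ p)).mdifferentiableAt (by simp)
  have h1 := mfderiv_comp p (mdifferentiableAt_chart hκ hp.2) (hu'.comp p hs)
  rw [mfderiv_comp p hu' hs] at h1
  have h2 : comps κ (mfderiv (𝓘(ℝ, ℝ).prod (𝓡 d)) (𝓡 n) u (spacetimePoint φ p)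
      (spacetimeVec φ α p)) = fderiv ℝ (localRep φ κ u) p (EuclideanSpace.single α 1) := by
    rw [← mfderiv_eq_fderiv]
    exact (DFunLike.congr_fun h1 (EuclideanSpace.single α 1)).symm
  have h3 := ((EuclideanSpace.proj k : Coord n →L[ℝ] ℝ).hasFDerivAt.comp p
      (smooth_differentiableAt (smooth_localRep hu hφ hκ hp)).hasFDerivAt).fderiv
  rw [h2, pd]
  change _ = fderiv ℝ (⇑(EuclideanSpace.proj k : Coord n →L[ℝ] ℝ) ∘ localRep φ κ u) p _
  rw [h3]
  rfl

variable [IsManifold (𝓡 n) ∞ N] {e : Fin n → ∀ z : ℝ × M, TangentSpace (𝓡 n) (u z)}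

theorem frameForm_eq (h : Metric n N) (a : Fin n) (α : Fin (d + 1)) :
    frameForm h φ u e a α p = frameDiff (metricCoeff h κ) (localRep φ κ u)
      (frameComp φ κ u e) a α p := by
  rw [frameForm, inner_eq_sum h hκ hp.2]
  simp only [comps_mfderiv hu hφ hκ hp]
  rfl

omit hp in
theorem isFrameAlong (h : Metric n N) (he : IsOrthonormalFrame (d := d) h u e) :
    IsFrameAlong (chartDomain φ κ u) (metricCoeff h κ) (localRep φ κ u) (frameComp φ κ u e) where
  isOpen := isOpen_chartDomain hφ hu.continuous
  symm := metricCoeff_symm h κ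
  det_ne_zero p hp := det_metricCoeff_ne_zero h hκ (κ.map_source hp.2)
  smooth_metric p hp := smooth_metricCoeff h hκ (κ.map_source hp.2)
  smooth_map p hp := smooth_localRep hu hφ hκ hp
  smooth_frame p hp a k := by
    have h1 := (he.smooth a).contMDiffAt.comp p (smooth_spacetimePoint hφ hp.1)
    exact smooth_coord (smooth_comps hκ (v := fun z => e a (spacetimePoint φ z)) h1 hp.2).contDiffAt k
  orthonormal p hp a b := by
    rw [← he.orthonormal (spacetimePoint φ p), inner_eq_sum h hκ hp.2]
    rfl

end Maps

end WaveMap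

end

/-! ### The wave equation for `q`. -/

theorem mainTheorem7 {d n : ℕ}
    {M : Type*} [TopologicalSpace M] [ChartedSpace (WaveMap.Coord d) M] [IsManifold (𝓡 d) ∞ M]
    {N : Type*} [TopologicalSpace N] [ChartedSpace (WaveMap.Coord n) N] [IsManifold (𝓡 n) ∞ N]
    (g : WaveMap.Metric d M) (h : WaveMap.Metric n N)
    (u : ℝ × M → N) (hu : ContMDiff (𝓘(ℝ, ℝ).prod (𝓡 d)) (𝓡 n) ∞ u)
    (hwave : WaveMap.IsWaveMap g h u)
    (e : Fin n → ∀ z : ℝ × M, TangentSpace (𝓡 n) (u z))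
    (he : WaveMap.IsOrthonormalFrame (d := d) h u e)
    (φ : OpenPartialHomeomorph M (WaveMap.Coord d))
    (hφ : φ ∈ IsManifold.maximalAtlas (𝓡 d) ∞ M)
    (κ : OpenPartialHomeomorph N (WaveMap.Coord n))
    (hκ : κ ∈ IsManifold.maximalAtlas (𝓡 n) ∞ N)
    (p : WaveMap.Coord (d + 1)) (hp : p ∈ WaveMap.chartDomain φ κ u) :
    let η := WaveMap.eta g φ
    let q := WaveMap.frameForm h φ u e
    let A := WaveMap.connForm h φ κ u e
    let F := WaveMap.curvForm h φ κ u e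
    -- `δ q^c = A^c_{a,α} η^{αβ} q^a_β`
    (∀ c, WaveMap.codiff₁ η (q c) p = ∑ a, ∑ α, ∑ β, A c a α p * (η p)⁻¹ α β * q a β p) ∧
    -- `d q^c = - A^c_b ∧ q^b`
    (∀ c α β, WaveMap.extD (q c) α β p =
      -∑ b, (A c b α p * q b β p - A c b β p * q b α p)) ∧
    -- `(□q)_γ = F_{γα} q^α + A_α A^α q_γ + (∇^α A)_α q_γ + 2 A^α (∇_α q)_γ`
    (∀ c γ, WaveMap.hodgeLaplacian η (q c) γ p =
      (∑ a, ∑ α, ∑ β, F c a γ α p * ((η p)⁻¹ α β * q a β p)) +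
      (∑ b, ∑ a, ∑ α, ∑ β, A c b α p * ((η p)⁻¹ α β * A b a β p) * q a γ p) +
      (∑ a, (∑ α, ∑ β, (η p)⁻¹ α β * WaveMap.nabla₁ η (A c a) β α p) * q a γ p) +
      2 * ∑ a, ∑ α, ∑ β, ((η p)⁻¹ α β * A c a β p) * WaveMap.nabla₁ η (q a) α γ p) := by

  intro η q A F
  have hE := WaveMap.isFrameAlong hu hφ hκ h he
  have hq : ∀ a α, ∀ z ∈ WaveMap.chartDomain φ κ u, q a α z = WaveMap.frameDiff
      (WaveMap.metricCoeff h κ) (WaveMap.localRep φ κ u) (WaveMap.frameComp φ κ u e) a α z :=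
    fun a α z hz => WaveMap.frameForm_eq hu hφ hκ hz h a α
  -- `q` is defined through `mfderiv`, without `κ`, and agrees with `frameDiff` only on the chart
  -- domain. Openness gives equality of germs, as derivatives require.
  have hev : ∀ z ∈ WaveMap.chartDomain φ κ u, ∀ a α, q a α =ᶠ[nhds z] WaveMap.frameDiff
      (WaveMap.metricCoeff h κ) (WaveMap.localRep φ κ u) (WaveMap.frameComp φ κ u e) a α := by
    intro z hz a α
    filter_upwards [hE.eventually_mem hz] with z' hz' using hq a α z' hz'
  have hδ : ∀ z ∈ WaveMap.chartDomain φ κ u, ∀ c, WaveMap.codiff₁ η (q c) z =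
      ∑ a, ∑ α, ∑ β, A c a α z * (η z)⁻¹ α β * q a β z := by
    intro z hz c
    have hη := WaveMap.smooth_eta g hφ hz.1
    have hdet := WaveMap.det_eta_ne_zero g hφ hz.1
    have hwz : ∀ k, ∑ α, WaveMap.covD (WaveMap.metricCoeff h κ) (WaveMap.localRep φ κ u) α
        (fun z k => WaveMap.sqrtDet η z * ∑ β, (η z)⁻¹ α β *
          WaveMap.pd β (fun z' => WaveMap.localRep φ κ u z' k) z) z k = 0 := fun k =>
      (mul_eq_zero.1 (hwave φ hφ κ hκ z hz k)).resolve_left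
        (one_div_ne_zero (WaveMap.sqrtDet_pos hdet).ne')
    have h1 := hE.codiff₁_frameDiff hz hη hdet hwz c
    -- In divergence form the codifferential involves only values and first derivatives of the
    -- components, which carry over from `frameDiff` to `q`.
    rw [WaveMap.codiff₁_eq hη (WaveMap.eta_symm g φ) hdet (hE.smooth_frameDiff hz c)] at h1
    rw [WaveMap.codiff₁_eq hη (WaveMap.eta_symm g φ) hdet fun α =>
      (hE.smooth_frameDiff hz c α).congr_of_eventuallyEq (hev z hz c α)]
    simp only [WaveMap.nabla₁, WaveMap.pd_congr (hev z hz _ _), hq _ _ z hz] at h1 ⊢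
    exact h1
  have hd : ∀ z ∈ WaveMap.chartDomain φ κ u, ∀ c α β, WaveMap.extD (q c) α β z =
      -∑ b, (A c b α z * q b β z - A c b β z * q b α z) := by
    intro z hz c α β
    have h1 := hE.extD_frameDiff hz c α β
    simp only [WaveMap.extD, WaveMap.pd_congr (hev z hz _ _), hq _ _ z hz] at h1 ⊢
    exact h1
  refine ⟨hδ p hp, hd p hp, fun c γ => ?_⟩
  -- Unlike `q`, the forms `A` and `F` unfold to `frameConn` and `frameCurv`, so no germ argument is
  -- needed for them.
  exact WaveMap.hodgeLaplacian_eq (WaveMap.smooth_eta g hφ hp.1) (WaveMap.eta_symm g φ)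
    (WaveMap.det_eta_ne_zero g hφ hp.1)
    (fun a α => (hE.smooth_frameDiff hp a α).congr_of_eventuallyEq (hev p hp a α))
    (fun c a α => hE.smooth_frameConn hp c a α)
    (fun c => (hE.eventually_mem hp).mono fun z hz => hδ z hz c)
    (fun c α β => (hE.eventually_mem hp).mono fun z hz => hd z hz c α β)
    (F := fun c a α β => F c a α β p)
    (fun c a α β => hE.frameCurv_eq hp c a α β) c γ
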